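/- Let $\{X_i\}_{i\in\mathbb{N}}$ be a sequence of Banach spaces, all real or all complex, whose dual spaces $X_i^*$ are (norm) separable and uniformly convex, and let $$\delta_i(\varepsilon)=\inf\Big\{1-\Big\|\frac{x^*+y^*}{2}\Big\| : x^*,y^*\in X_i^*,\ \|x^*\|=\|y^*\|=1,\ \|x^*-y^*\|\ge\varepsilon\Big\}\qquad(\inf\emptyset=\infty)$$ be the modulus of convexity of $X_i^*$. Suppose that $\inf_{i}\delta_i(\varepsilon)>0$ for every $0<\varepsilon<1$. Let $X=\left[\bigoplus X_i\right]_{c_0}$ (the sequences $(x_i)$ with $x_i\in X_i$ and $\|x_i\|\to 0$, with norm $\sup_i\|x_i\|$) or $X=\left[\bigoplus X_i\right]_{\ell_p}$ for some $1\le p<\infty$ (the sequences $(x_i)$ with $x_i\in X_i$ and $\|(x_i)\|=(\sum_i\|x_i\|^p)^{1/p}<\infty$). Then $X^*$ admits a uniformly simultaneously continuous retraction; that is, there is a map $r:X^*\to B_{X^*}$ onto the closed unit ball $B_{X^*}$ of $X^*$ such that $r(x^*)=x^*$ for all $x^*\in B_{X^*}$, and $r$ is both uniformly continuous for the norm and weak-$*$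 to weak-$*$ continuous. -/

import Mathlib

open Filter Topology
open scoped ENNReal

/-- The modulus of convexity of a normed space `E`: the infimum of `1 - ‖(x + y) / 2‖` over unit
vectors `x`, `y` with `‖x - y‖ ≥ ε`. These numbers are nonnegative, and the infimum is taken in
`[0, ∞]`, so that it is `∞` over the empty set (which occurs, for example, for `E = 0`). -/
noncomputable def modulusOfConvexity (E : Type*) [NormedAddCommGroup E] (ε : ℝ) : ℝ≥0∞ :=
  ⨅ (x : E) (y : E) (_ : ‖x‖ = 1) (_ : ‖y‖ = 1) (_ : ε ≤ ‖x - y‖),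
    ENNReal.ofReal (1 - ‖x + y‖ / 2)

/-- The `c₀`-sum of a family of normed spaces: the families `(x i)` with `‖x i‖ → 0`, with the
norm `sup i, ‖x i‖` inherited from the `ℓ_∞`-sum. -/
def c0Sum (𝕜 : Type*) [RCLike 𝕜] {ι : Type*} (X : ι → Type*)
    [∀ i, NormedAddCommGroup (X i)] [∀ i, NormedSpace 𝕜 (X i)] : Submodule 𝕜 (lp X ∞) where
  carrier := {x | Tendsto (fun i => ‖x i‖) cofinite (𝓝 0)}
  zero_mem' := by simpa using tendsto_const_nhds
  add_mem' := by
    intro x y hx hy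
    simp only [Set.mem_ofPred_eq] at hx hy ⊢
    refine squeeze_zero (fun i => norm_nonneg _) (fun i => ?_) (by simpa using hx.add hy)
    simpa using norm_add_le (x i) (y i)
  smul_mem' := by
    intro c x hx
    simp only [Set.mem_ofPred_eq] at hx ⊢
    simpa [norm_smul] using hx.const_mul ‖c‖

/-- The dual of `X` admits a uniformly simultaneously continuous retraction: there is a retraction
of the dual onto its closed unit ball which is uniformly continuous for the norm and continuous
for the weak-* topology. -/
def AdmitsUniformlySimultaneouslyContinuousRetraction (𝕜 : Type*) [RCLike 𝕜] (X : Type*)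
    [NormedAddCommGroup X] [NormedSpace 𝕜 X] : Prop :=
  ∃ r : StrongDual 𝕜 X → StrongDual 𝕜 X,
    (∀ f, ‖r f‖ ≤ 1) ∧
    (∀ f, ‖f‖ ≤ 1 → r f = f) ∧
    UniformContinuous r ∧
    Continuous (fun f : WeakDual 𝕜 X => StrongDual.toWeakDual (r (WeakDual.toStrongDual f)))

/-! For a finite-dimensional subspace `E`, uniform convexity of the dual makes the minimal-norm
Hahn–Banach extension of `f|E` depend norm-continuously on `f|E`, hence weak-* to norm continuously
on `f`. An increasing exhaustion by such subspaces gives maps `F n` with `F 0 = 0` and `F n ∘ F m =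
F n` for `n ≤ m`, which reproduce `f` on more and more vectors. Joining the `F n f` by segments
gives a path from 0 towards `f` along which the norm never decreases. The retraction sends `f` to a
point where this path leaves the unit ball, or to `f` if it never does. Path points with norms close
to 1 are close to each other, so exit points are stable under perturbation
(`norm_isExitPoint_sub_le`). This yields both norm uniform continuity, with a modulus depending only
on the convexity constants (`exists_uniform_retraction`), and weak-* continuity
(`tendsto_exitMap_apply`).

For c₀ and ℓ_p with p > 1, the dual is an ℓ_q-sum with 1 ≤ q < ∞, and the construction runs on the
whole sum. For c₀ (q = 1) the dual need not be uniformly convex, but norms increase along segments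
in every coordinate, and superadditivity of t ↦ t^q then suffices (`exists_segmentEstimate`). For
ℓ_1 the dual ball is the product of the dual balls, and retractions with a common modulus are
applied coordinatewise (`admits_retraction_l1`). -/

/-! ### Uniform convexity in linear form -/

/-- A linear form of uniform convexity: vectors `u`, `v` of norm at most `M` whose sum has norm
close to `2 * M` are close to each other. -/
def ConvexityEstimate (E : Type*) [NormedAddCommGroup E] (ε C : ℝ) : Prop :=
  ∀ (u v : E) (M : ℝ), ‖u‖ ≤ M → ‖v‖ ≤ M → ‖u - v‖ ≤ ε * M + C * (2 * M - ‖u + v‖)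

theorem norm_sub_inv_norm_smul {E : Type*} [NormedAddCommGroup E] [NormedSpace ℝ E] {u : E}
    (hu : u ≠ 0) {M : ℝ} (h : ‖u‖ ≤ M) : ‖u - (M * ‖u‖⁻¹) • u‖ = M - ‖u‖ := by
  have h0 : 0 < ‖u‖ := norm_pos_iff.2 hu
  have : u - (M * ‖u‖⁻¹) • u = (1 - M * ‖u‖⁻¹) • u := by module
  rw [this, norm_smul, Real.norm_eq_abs, abs_sub_comm, abs_of_nonneg]
  · field_simp
  · rw [sub_nonneg, ← div_eq_mul_inv, le_div_iff₀ h0]; simpa using h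

/-- If the defect `2 * M - ‖u + v‖` is at least `κ * M`, the second term alone bounds `2 * M`.
Otherwise both norms exceed `(1 - κ) * M`, so rescaling to the sphere moves each vector by at most
`κ * M`; `3 * κ < δ` then forces the normalized vectors to be `ε`-close. -/
theorem convexityEstimate_of_sphere {E : Type*} [NormedAddCommGroup E] [NormedSpace ℝ E]
    {ε δ κ : ℝ} (hκ : 0 < κ) (hκε : κ ≤ ε) (hκδ : 3 * κ < δ) (hκ1 : κ < 1)
    (h : ∀ x y : E, ‖x‖ = 1 → ‖y‖ = 1 → ε ≤ ‖x - y‖ → ‖x + y‖ ≤ 2 - δ) :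
    ConvexityEstimate E (3 * ε) (2 / κ) := by
  intro u v M hu hv
  have hM : 0 ≤ M := (norm_nonneg u).trans hu
  have hD : 0 ≤ 2 * M - ‖u + v‖ := by linarith [norm_add_le u v]
  rcases le_or_gt (κ * M) (2 * M - ‖u + v‖) with hc | hc
  · have h1 : 2 * M ≤ 2 / κ * (2 * M - ‖u + v‖) := by
      rw [div_mul_eq_mul_div, le_div_iff₀ hκ]; linarith
    have h2 : 0 ≤ 3 * ε * M := by have := hκ.trans_le hκε; positivity
    linarith [norm_sub_le u v]
  have hM0 : 0 < M := by
    rcases hM.eq_or_lt with h0 | h0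
    · rw [← h0] at hc hD; linarith
    · exact h0
  have hκM : κ * M < M := by nlinarith
  have hu1 : M - κ * M ≤ ‖u‖ := by linarith [norm_add_le u v]
  have hv1 : M - κ * M ≤ ‖v‖ := by linarith [norm_add_le u v]
  have hu0 : u ≠ 0 := by rw [← norm_pos_iff]; linarith
  have hv0 : v ≠ 0 := by rw [← norm_pos_iff]; linarith
  have hun := norm_sub_inv_norm_smul hu0 hu
  have hvn := norm_sub_inv_norm_smul hv0 hv
  set x : E := ‖u‖⁻¹ • u with hx
  set y : E := ‖v‖⁻¹ • v with hy
  rw [mul_smul, ← hx] at hun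
  rw [mul_smul, ← hy] at hvn
  have hxn : ‖x‖ = 1 := by
    rw [hx, norm_smul, norm_inv, norm_norm, inv_mul_cancel₀ (norm_ne_zero_iff.2 hu0)]
  have hyn : ‖y‖ = 1 := by
    rw [hy, norm_smul, norm_inv, norm_norm, inv_mul_cancel₀ (norm_ne_zero_iff.2 hv0)]
  have hsum : ‖u + v‖ ≤ M * ‖x + y‖ + 2 * (κ * M) := by
    have e : u + v = M • (x + y) + ((u - M • x) + (v - M • y)) := by module
    calc ‖u + v‖ ≤ ‖M • (x + y)‖ + (‖u - M • x‖ + ‖v - M • y‖) := by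
          conv_lhs => rw [e]
          exact (norm_add_le _ _).trans (add_le_add_right (norm_add_le _ _) _)
      _ ≤ M * ‖x + y‖ + 2 * (κ * M) := by
          rw [norm_smul, Real.norm_of_nonneg hM, hun, hvn]; linarith
  have hxy : ‖x - y‖ < ε := by
    by_contra hcon
    have := mul_le_mul_of_nonneg_left (h x y hxn hyn (not_lt.1 hcon)) hM
    nlinarith
  have e : u - v = M • (x - y) + ((u - M • x) - (v - M • y)) := by module
  have : ‖u - v‖ ≤ ‖M • (x - y)‖ + (‖u - M • x‖ + ‖v - M • y‖) := by
    conv_lhs => rw [e]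
    exact (norm_add_le _ _).trans (add_le_add_right (norm_sub_le _ _) _)
  rw [norm_smul, Real.norm_of_nonneg hM, hun, hvn] at this
  have h1 : M * ‖x - y‖ ≤ M * ε := mul_le_mul_of_nonneg_left hxy.le hM
  have h2 : κ * M ≤ ε * M := mul_le_mul_of_nonneg_right hκε hM
  have h3 : 0 ≤ 2 / κ * (2 * M - ‖u + v‖) := by positivity
  linarith

theorem exists_convexityEstimate {ι : Type*} (E : ι → Type*) [∀ i, NormedAddCommGroup (E i)]
    [∀ i, NormedSpace ℝ (E i)]
    (hδ : ∀ ε : ℝ, 0 < ε → ε < 1 → 0 < ⨅ i, modulusOfConvexity (E i) ε) {ε : ℝ} (hε : 0 < ε) :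
    ∃ C, 0 < C ∧ ∀ i, ConvexityEstimate (E i) ε C := by
  obtain ⟨η, hη, hηε, hη1⟩ : ∃ η : ℝ, 0 < η ∧ 3 * η ≤ ε ∧ η < 1 :=
    ⟨min (ε / 3) (1 / 2), by positivity, by linarith [min_le_left (ε / 3) (1 / 2)],
      (min_le_right _ _).trans_lt (by norm_num)⟩
  obtain ⟨d, hd, hdδ⟩ := ENNReal.lt_iff_exists_real_btwn.1 (hδ η hη hη1)
  obtain ⟨hd0, hdδ⟩ := hdδ
  have hd0 : 0 < d := ENNReal.ofReal_pos.1 hd0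
  -- A value of the modulus above `d` means `‖x + y‖ < 2 - 2 * d`, so `2 * d` serves as the `δ` of
  -- the sphere condition.
  obtain ⟨κ, hκ, hκη, hκd, hκ1⟩ : ∃ κ : ℝ, 0 < κ ∧ κ ≤ η ∧ 3 * κ < 2 * d ∧ κ < 1 :=
    ⟨min η (d / 3), by positivity, min_le_left _ _, by linarith [min_le_right η (d / 3)],
      (min_le_left _ _).trans_lt hη1⟩
  refine ⟨2 / κ, by positivity, fun i u v M hu hv => ?_⟩
  have key : ConvexityEstimate (E i) (3 * η) (2 / κ) := by
    refine convexityEstimate_of_sphere hκ hκη hκd hκ1 fun x y hx hy hxy => ?_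
    have h1 : ENNReal.ofReal d < ENNReal.ofReal (1 - ‖x + y‖ / 2) :=
      hdδ.trans_le ((iInf_le _ i).trans
        (iInf_le_of_le x (iInf_le_of_le y (iInf_le_of_le hx (iInf_le_of_le hy
          (iInf_le_of_le hxy le_rfl))))))
    have := (ENNReal.ofReal_lt_ofReal_iff_of_nonneg hd0.le).1 h1
    linarith
  have hM : 0 ≤ M := (norm_nonneg u).trans hu
  exact (key u v M hu hv).trans (add_le_add_left (mul_le_mul_of_nonneg_right hηε hM) _)

/-! ### Segments starting at a point of minimal norm -/

section Segment

variable {E : Type*} [NormedAddCommGroup E] [NormedSpace ℝ E]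

/-- If `a` has minimal norm on the segment from `a` to `b`, then the norm increases along it. -/
theorem norm_segment_mono {a b : E} (h : ∀ s : ℝ, 0 ≤ s → s ≤ 1 → ‖a‖ ≤ ‖(1 - s) • a + s • b‖)
    {s t : ℝ} (hs : 0 ≤ s) (hst : s ≤ t) (ht : t ≤ 1) :
    ‖(1 - s) • a + s • b‖ ≤ ‖(1 - t) • a + t • b‖ := by
  rcases (hs.trans hst).eq_or_lt with h0 | h0
  · obtain rfl : s = t := by linarith
    rfl
  -- The point at `s` lies between `a` and the point at `t`, and `a` has the smaller norm of these
  -- two.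
  have e : (1 - s) • a + s • b = (1 - s / t) • a + (s / t) • ((1 - t) • a + t • b) := by
    match_scalars <;> field_simp; ring
  have h1 : s / t ≤ 1 := (div_le_one h0).2 hst
  have h2 : 0 ≤ s / t := by positivity
  calc ‖(1 - s) • a + s • b‖
      ≤ (1 - s / t) * ‖a‖ + s / t * ‖(1 - t) • a + t • b‖ := by
        rw [e]
        refine (norm_add_le _ _).trans ?_
        rw [norm_smul, norm_smul, Real.norm_of_nonneg h2, Real.norm_of_nonneg (by linarith)]
    _ ≤ (1 - s / t) * ‖(1 - t) • a + t • b‖ + s / t * ‖(1 - t) • a + t • b‖ := by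
        exact add_le_add_left (mul_le_mul_of_nonneg_left (h t h0.le ht) (by linarith)) _
    _ = _ := by ring

/-- The midpoint of the two points lies further along the segment than the first, so its norm is no
smaller; the defect is therefore at most twice the difference of the norms. -/
theorem ConvexityEstimate.norm_segment_sub_le {ε C : ℝ} (hC : ConvexityEstimate E ε C)
    (hC0 : 0 ≤ C) {a b : E} (h : ∀ s : ℝ, 0 ≤ s → s ≤ 1 → ‖a‖ ≤ ‖(1 - s) • a + s • b‖)
    {s t : ℝ} (hs : 0 ≤ s) (hst : s ≤ t) (ht : t ≤ 1) :
    ‖((1 - s) • a + s • b) - ((1 - t) • a + t • b)‖ ≤ ε * ‖(1 - t) • a + t • b‖ +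
      2 * C * (‖(1 - t) • a + t • b‖ - ‖(1 - s) • a + s • b‖) := by
  refine (hC _ _ _ (norm_segment_mono h hs hst ht) le_rfl).trans ?_
  have h1 := norm_segment_mono h hs (by linarith : s ≤ (s + t) / 2) (by linarith)
  have e : (1 - s) • a + s • b + ((1 - t) • a + t • b) =
      (2 : ℝ) • ((1 - (s + t) / 2) • a + ((s + t) / 2) • b) := by
    match_scalars <;> ring
  have h2 : 2 * ‖(1 - s) • a + s • b‖ ≤ ‖(1 - s) • a + s • b + ((1 - t) • a + t • b)‖ := by
    rw [e, norm_smul]; simpa using h1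
  nlinarith

end Segment

/-! ### Extensions of minimal norm -/

section MinimalExtension

variable {𝕜 : Type*} [RCLike 𝕜] {X : Type*} [NormedAddCommGroup X] [NormedSpace 𝕜 X]

/-- An extension of minimal norm of the restriction of `f` to the subspace `E`. -/
noncomputable def minExt (E : Submodule 𝕜 X) (f : StrongDual 𝕜 X) : StrongDual 𝕜 X :=
  Classical.choose (exists_extension_norm_eq E (f.comp E.subtypeL))

theorem minExt_apply (E : Submodule 𝕜 X) (f : StrongDual 𝕜 X) {x : X} (hx : x ∈ E) :
    minExt E f x = f x :=
  (Classical.choose_spec (exists_extension_norm_eq E (f.comp E.subtypeL))).1 ⟨x, hx⟩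

theorem norm_minExt (E : Submodule 𝕜 X) (f : StrongDual 𝕜 X) :
    ‖minExt E f‖ = ‖f.comp E.subtypeL‖ :=
  (Classical.choose_spec (exists_extension_norm_eq E (f.comp E.subtypeL))).2

theorem minExt_congr {E : Submodule 𝕜 X} {f g : StrongDual 𝕜 X} (h : ∀ x ∈ E, f x = g x) :
    minExt E f = minExt E g := by
  have : f.comp E.subtypeL = g.comp E.subtypeL := by ext x; exact h x x.2
  simp only [minExt, this]

theorem minExt_minExt {E G : Submodule 𝕜 X} (h : E ≤ G) (f : StrongDual 𝕜 X) :
    minExt E (minExt G f) = minExt E f :=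
  minExt_congr fun _ hx => minExt_apply G f (h hx)

theorem minExt_bot (f : StrongDual 𝕜 X) : minExt ⊥ f = 0 := by
  rw [← norm_eq_zero, norm_minExt, norm_eq_zero]
  ext x
  simp [Subsingleton.elim x 0]

theorem norm_comp_subtypeL_le (E : Submodule 𝕜 X) (f : StrongDual 𝕜 X) :
    ‖f.comp E.subtypeL‖ ≤ ‖f‖ :=
  ContinuousLinearMap.opNorm_le_bound _ (norm_nonneg _) fun x => f.le_opNorm x

theorem norm_minExt_le {E : Submodule 𝕜 X} {f g : StrongDual 𝕜 X} (h : ∀ x ∈ E, g x = f x) :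
    ‖minExt E f‖ ≤ ‖g‖ := by
  rw [← minExt_congr h, norm_minExt]
  exact norm_comp_subtypeL_le E g

/-- All points of the line through `minExt E g` and `g` restrict to `g` on `E`. -/
theorem norm_minExt_le_segment (E : Submodule 𝕜 X) (g : StrongDual 𝕜 X) (s : ℝ) :
    ‖minExt E g‖ ≤ ‖(1 - s) • minExt E g + s • g‖ := by
  refine norm_minExt_le fun x hx => ?_
  simp only [add_apply, smul_apply, minExt_apply E g hx]
  module

/-- The sum of the two extensions restricts on `E` to `2 • f` up to an error of norm `d`, while both
have norm at most `‖minExt E f‖ + d`. The defect is thus at most `3 * d`. -/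
theorem ConvexityEstimate.norm_minExt_sub_le {ε C : ℝ}
    (hC : ConvexityEstimate (StrongDual 𝕜 X) ε C) (hC0 : 0 ≤ C) (E : Submodule 𝕜 X)
    (f g : StrongDual 𝕜 X) :
    ‖minExt E f - minExt E g‖ ≤ ε * ‖minExt E f‖ + (ε + 3 * C) * ‖(f - g).comp E.subtypeL‖ := by
  set d := ‖(f - g).comp E.subtypeL‖ with hd
  have hg : ‖minExt E g‖ ≤ ‖minExt E f‖ + d := by
    have e : g.comp E.subtypeL = f.comp E.subtypeL - (f - g).comp E.subtypeL := by ext x; simp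
    rw [norm_minExt, norm_minExt, e]
    exact norm_sub_le _ _
  have hs : 2 * ‖minExt E f‖ - d ≤ ‖minExt E f + minExt E g‖ := by
    have e : (2 : ℝ) • f.comp E.subtypeL =
        (minExt E f + minExt E g).comp E.subtypeL + (f - g).comp E.subtypeL := by
      ext x
      simp [minExt_apply E _ x.2, two_smul]
    have h1 : 2 * ‖minExt E f‖ = ‖(2 : ℝ) • f.comp E.subtypeL‖ := by
      rw [norm_smul, norm_minExt]; simp
    have h2 := norm_add_le ((minExt E f + minExt E g).comp E.subtypeL) ((f - g).comp E.subtypeL)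
    have h3 := norm_comp_subtypeL_le E (minExt E f + minExt E g)
    rw [← e, ← h1] at h2
    linarith
  have hd0 : 0 ≤ d := norm_nonneg _
  have := hC (minExt E f) (minExt E g) (‖minExt E f‖ + d) (by linarith) hg
  nlinarith

theorem continuous_minExt (h : ∀ ε : ℝ, 0 < ε → ∃ C, 0 < C ∧
      ConvexityEstimate (StrongDual 𝕜 X) ε C) (E : Submodule 𝕜 X) [FiniteDimensional 𝕜 E] :
    Continuous fun f : WeakDual 𝕜 X => minExt E (WeakDual.toStrongDual f) := by
  -- Finite dimension of `E` enters here: pointwise convergence on `E` is norm convergence of the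
  -- restrictions.
  have hr : Continuous fun f : WeakDual 𝕜 X =>
      (WeakDual.toStrongDual f : StrongDual 𝕜 X).comp E.subtypeL :=
    continuous_clm_apply.2 fun y => WeakDual.eval_continuous (y : X)
  rw [continuous_iff_continuousAt]
  intro f
  rw [ContinuousAt, Metric.tendsto_nhds]
  intro ε hε
  set a := ‖minExt E (WeakDual.toStrongDual f)‖ with ha
  have ha0 : 0 ≤ a := norm_nonneg _
  obtain ⟨C, hC, hCE⟩ := h (ε / (2 * (a + 1))) (by positivity)
  set η := ε / (2 * (a + 1)) with hη
  have hη0 : 0 < η := by positivity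
  have hηa : η * a < ε / 2 := by
    rw [hη, div_mul_eq_mul_div, div_lt_div_iff₀ (by positivity) two_pos]
    nlinarith
  have := (Metric.tendsto_nhds.1 (hr.tendsto f)) (ε / 2 / (η + 3 * C)) (by positivity)
  filter_upwards [this] with g hg
  rw [dist_comm, dist_eq_norm] at hg ⊢
  rw [← ContinuousLinearMap.sub_comp, lt_div_iff₀ (by positivity), mul_comm] at hg
  have := hCE.norm_minExt_sub_le hC.le E (WeakDual.toStrongDual f) (WeakDual.toStrongDual g)
  linarith

end MinimalExtension

/-! ### The retraction built from an approximation scheme -/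

section Retraction

variable {𝕜 : Type*} [RCLike 𝕜] {X : Type*} [NormedAddCommGroup X] [NormedSpace 𝕜 X]

/-- The vectors at which all functionals are eventually reproduced by the maps `F n`. -/
def stableSubmodule (F : ℕ → StrongDual 𝕜 X → StrongDual 𝕜 X) : Submodule 𝕜 X where
  carrier := {x | ∃ n, ∀ m, n ≤ m → ∀ f, F m f x = f x}
  zero_mem' := ⟨0, by simp⟩
  add_mem' := by
    rintro x y ⟨n, hn⟩ ⟨m, hm⟩
    refine ⟨max n m, fun k hk f => ?_⟩
    rw [map_add, map_add, hn k (le_of_max_le_left hk), hm k (le_of_max_le_right hk)]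
  smul_mem' := by
    rintro c x ⟨n, hn⟩
    exact ⟨n, fun k hk f => by rw [map_smul, map_smul, hn k hk]⟩

/-- A sequence of weak-* to norm continuous maps of the dual which approximate the identity in the
way in which extensions of minimal norm of restrictions to growing subspaces do. -/
structure ApproximationScheme (F : ℕ → StrongDual 𝕜 X → StrongDual 𝕜 X) : Prop where
  zero : ∀ f, F 0 f = 0
  comp : ∀ n m, n ≤ m → ∀ f, F n (F m f) = F n f
  norm_le : ∀ n g (s : ℝ), 0 ≤ s → s ≤ 1 → ‖F n g‖ ≤ ‖(1 - s) • F n g + s • g‖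
  continuous : ∀ n, Continuous fun f : WeakDual 𝕜 X => F n (WeakDual.toStrongDual f)
  dense : Dense (stableSubmodule F : Set X)

/-- On the segments from `F n g` to `g`, points with norms almost `1` are `ε`-close. -/
def SegmentEstimate (F : ℕ → StrongDual 𝕜 X → StrongDual 𝕜 X) (ε δ : ℝ) : Prop :=
  ∀ n g (s t : ℝ), 0 ≤ s → s ≤ t → t ≤ 1 → ‖(1 - t) • F n g + t • g‖ ≤ 1 + δ →
    1 - δ ≤ ‖(1 - s) • F n g + s • g‖ →
      ‖((1 - s) • F n g + s • g) - ((1 - t) • F n g + t • g)‖ ≤ ε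

/-- A uniform continuity estimate for the maps `F n`. -/
def ContinuityEstimate (F : ℕ → StrongDual 𝕜 X → StrongDual 𝕜 X) (ε C : ℝ) : Prop :=
  ∀ n f g, ‖F n f - F n g‖ ≤ ε * ‖F n f‖ + C * ‖f - g‖

/-- The point with parameter `s` on the segment from `F k f` to `F (k + 1) f`. -/
noncomputable def pathPoint (F : ℕ → StrongDual 𝕜 X → StrongDual 𝕜 X) (k : ℕ) (s : ℝ)
    (f : StrongDual 𝕜 X) : StrongDual 𝕜 X :=
  (1 - s) • F k f + s • F (k + 1) f

/-- `r` is the last point in the unit ball of the path through all `F k f`, which ends in `f`. -/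
def IsExitPoint (F : ℕ → StrongDual 𝕜 X → StrongDual 𝕜 X) (f r : StrongDual 𝕜 X) : Prop :=
  (∃ k s, 0 ≤ s ∧ s ≤ 1 ∧ r = pathPoint F k s f ∧ ‖r‖ = 1 ∧ 1 < ‖F (k + 1) f‖) ∨
    (r = f ∧ ‖f‖ ≤ 1)

/-- `u` comes before `v` on a path of increasing norm, on which points with norms almost `1`
are `ε`-close. -/
def Precedes (ε δ : ℝ) (u v : StrongDual 𝕜 X) : Prop :=
  ‖u‖ ≤ ‖v‖ ∧ (‖v‖ ≤ 1 + δ → 1 - δ ≤ ‖u‖ → ‖u - v‖ ≤ ε)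

theorem Precedes.trans {ε ε' δ : ℝ} {u v w : StrongDual 𝕜 X} (h : Precedes ε δ u v)
    (h' : Precedes ε' δ v w) : Precedes (ε + ε') δ u w := by
  refine ⟨h.1.trans h'.1, fun hw hu => ?_⟩
  have h1 := h.2 (h'.1.trans hw) hu
  have h2 := h'.2 hw (hu.trans h.1)
  calc ‖u - w‖ = ‖(u - v) + (v - w)‖ := by congr 1; abel
    _ ≤ ε + ε' := (norm_add_le _ _).trans (add_le_add h1 h2)

theorem Precedes.mono {ε ε' δ : ℝ} {u v : StrongDual 𝕜 X} (h : Precedes ε δ u v) (hε : ε ≤ ε') :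
    Precedes ε' δ u v :=
  ⟨h.1, fun hv hu => (h.2 hv hu).trans hε⟩

variable {F : ℕ → StrongDual 𝕜 X → StrongDual 𝕜 X}

theorem segment_zero (f g : StrongDual 𝕜 X) :
    (1 - (0 : ℝ)) • f + (0 : ℝ) • g = f := by
  module

theorem segment_one (f g : StrongDual 𝕜 X) : (1 - (1 : ℝ)) • f + (1 : ℝ) • g = g := by
  module

theorem pathPoint_zero (k : ℕ) (f : StrongDual 𝕜 X) : pathPoint F k 0 f = F k f :=
  segment_zero _ _

theorem pathPoint_one (k : ℕ) (f : StrongDual 𝕜 X) : pathPoint F k 1 f = F (k + 1) f :=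
  segment_one _ _

namespace ApproximationScheme

variable (hF : ApproximationScheme F)
include hF

theorem precedes_segment {ε δ : ℝ} (hE : SegmentEstimate F ε δ) (n : ℕ) (g : StrongDual 𝕜 X)
    {s t : ℝ} (hs : 0 ≤ s) (hst : s ≤ t) (ht : t ≤ 1) :
    Precedes ε δ ((1 - s) • F n g + s • g) ((1 - t) • F n g + t • g) :=
  ⟨norm_segment_mono (hF.norm_le n g) hs hst ht, hE n g s t hs hst ht⟩

theorem precedes_pathPoint {ε δ : ℝ} (hE : SegmentEstimate F ε δ) (k : ℕ) (f : StrongDual 𝕜 X)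
    {s t : ℝ} (hs : 0 ≤ s) (hst : s ≤ t) (ht : t ≤ 1) :
    Precedes ε δ (pathPoint F k s f) (pathPoint F k t f) := by
  have := hF.precedes_segment hE k (F (k + 1) f) hs hst ht
  rwa [hF.comp k (k + 1) (Nat.le_succ k)] at this

theorem precedes_of_le {ε δ : ℝ} (hE : SegmentEstimate F ε δ) {n m : ℕ} (h : n ≤ m)
    (f : StrongDual 𝕜 X) : Precedes ε δ (F n f) (F m f) := by
  have := hF.precedes_segment hE n (F m f) le_rfl zero_le_one le_rfl
  rwa [segment_zero, segment_one, hF.comp n m h] at this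

theorem precedes_self {ε δ : ℝ} (hE : SegmentEstimate F ε δ) (n : ℕ) (f : StrongDual 𝕜 X) :
    Precedes ε δ (F n f) f := by
  have := hF.precedes_segment hE n f le_rfl zero_le_one le_rfl
  rwa [segment_zero, segment_one] at this

/-- The three `ε` pay for the rest of segment `k`, the jump from `F (k + 1) f` to `F l f`, and the
start of segment `l`. -/
theorem precedes_pathPoint_of_lt {ε δ : ℝ} (hE : SegmentEstimate F ε δ) {k l : ℕ} (h : k < l)
    (f : StrongDual 𝕜 X) {s t : ℝ} (hs : 0 ≤ s) (hs1 : s ≤ 1) (ht : 0 ≤ t) (ht1 : t ≤ 1) :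
    Precedes (3 * ε) δ (pathPoint F k s f) (pathPoint F l t f) := by
  have h1 := hF.precedes_pathPoint hE k f hs hs1 le_rfl
  have h2 := hF.precedes_of_le hE (Nat.succ_le_of_lt h) f
  have h3 := hF.precedes_pathPoint hE l f le_rfl ht ht1
  rw [pathPoint_one] at h1
  rw [pathPoint_zero] at h3
  exact ((h1.trans h2).trans h3).mono (by linarith)

theorem precedes_pathPoint_self {ε δ : ℝ} (hε : 0 ≤ ε) (hE : SegmentEstimate F ε δ) (k : ℕ)
    (f : StrongDual 𝕜 X) {s : ℝ} (hs : 0 ≤ s) (hs1 : s ≤ 1) :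
    Precedes (3 * ε) δ (pathPoint F k s f) f := by
  have h1 := hF.precedes_pathPoint hE k f hs hs1 le_rfl
  rw [pathPoint_one] at h1
  exact (h1.trans (hF.precedes_self hE (k + 1) f)).mono (by linarith)

theorem norm_apply_le (n : ℕ) (f : StrongDual 𝕜 X) : ‖F n f‖ ≤ ‖f‖ := by
  have := hF.norm_le n f 1 zero_le_one le_rfl
  rwa [segment_one] at this

theorem norm_le_one_of_forall {f : StrongDual 𝕜 X} (h : ∀ n, ‖F n f‖ ≤ 1) : ‖f‖ ≤ 1 := by
  refine f.opNorm_le_bound zero_le_one fun x => ?_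
  refine hF.dense.induction (P := fun x => ‖f x‖ ≤ 1 * ‖x‖) ?_
    (isClosed_le (by fun_prop) (by fun_prop)) x
  rintro x ⟨n, hn⟩
  rw [← hn n le_rfl f]
  exact (F n f).le_of_opNorm_le (h n) x

theorem exists_isExitPoint (f : StrongDual 𝕜 X) : ∃ r, IsExitPoint F f r := by
  classical
  by_cases h : ∃ n, 1 < ‖F n f‖
  -- The first index outside the ball is positive because `F 0 f = 0`; the norm takes the value 1 on
  -- the segment leading to it.
  · obtain ⟨k, hk⟩ : ∃ k, Nat.find h = k + 1 := by
      refine Nat.exists_eq_succ_of_ne_zero fun h0 => ?_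
      have := Nat.find_spec h
      rw [h0, hF.zero, norm_zero] at this
      linarith
    have h1 : 1 < ‖F (k + 1) f‖ := hk ▸ Nat.find_spec h
    have h0 : ‖F k f‖ ≤ 1 := not_lt.1 (Nat.find_min h (by omega))
    have hc : ContinuousOn (fun s : ℝ => ‖pathPoint F k s f‖) (Set.Icc 0 1) := by
      unfold pathPoint
      fun_prop
    obtain ⟨s, hs, hs1⟩ := intermediate_value_Icc zero_le_one hc
      (show (1 : ℝ) ∈ Set.Icc _ _ from ⟨by simpa [pathPoint_zero] using h0,
        by simpa [pathPoint_one] using h1.le⟩)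
    exact ⟨_, Or.inl ⟨k, s, hs.1, hs.2, rfl, hs1, h1⟩⟩
  · push Not at h
    exact ⟨f, Or.inr ⟨rfl, hF.norm_le_one_of_forall h⟩⟩

omit hF in
theorem _root_.IsExitPoint.norm_le {f r : StrongDual 𝕜 X} (h : IsExitPoint F f r) : ‖r‖ ≤ 1 := by
  rcases h with ⟨k, s, -, -, -, h, -⟩ | ⟨rfl, h⟩
  exacts [h.le, h]

/-- The clause `1 < ‖F (k + 1) f‖` of `IsExitPoint` rules out the first alternative when `f` is in
the ball. -/
theorem isExitPoint_eq_self {f r : StrongDual 𝕜 X} (h : IsExitPoint F f r) (hf : ‖f‖ ≤ 1) :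
    r = f := by
  rcases h with ⟨k, s, -, -, -, -, h⟩ | ⟨h, -⟩
  · linarith [hF.norm_apply_le (k + 1) f]
  · exact h

theorem precedes_or_precedes {ε δ : ℝ} (hε : 0 ≤ ε) (hE : SegmentEstimate F ε δ)
    {f r : StrongDual 𝕜 X} (h : IsExitPoint F f r) (k : ℕ) {s : ℝ} (hs : 0 ≤ s) (hs1 : s ≤ 1) :
    Precedes (3 * ε) δ (pathPoint F k s f) r ∨
      (Precedes (3 * ε) δ r (pathPoint F k s f) ∧ ‖r‖ = 1) := by
  rcases h with ⟨l, t, ht, ht1, rfl, h, -⟩ | ⟨rfl, h⟩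
  · rcases lt_trichotomy k l with hkl | rfl | hkl
    · exact Or.inl (hF.precedes_pathPoint_of_lt hE hkl f hs hs1 ht ht1)
    · rcases le_total s t with hst | hst
      · exact Or.inl ((hF.precedes_pathPoint hE k f hs hst ht1).mono (by linarith))
      · exact Or.inr ⟨(hF.precedes_pathPoint hE k f ht hst hs1).mono (by linarith), h⟩
    · exact Or.inr ⟨hF.precedes_pathPoint_of_lt hE hkl f ht ht1 hs hs1, h⟩
  · exact Or.inl (hF.precedes_pathPoint_self hε hE k r hs hs1)

/-- The point with the same parameters on the path of `g` has norm within `δ` of 1 and is comparable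
with the exit point of `g`, hence close to it. -/
theorem norm_isExitPoint_sub_le {ε δ : ℝ} (hε : 0 ≤ ε) (hδ : 0 ≤ δ) (hE : SegmentEstimate F ε δ)
    {f g r r' : StrongDual 𝕜 X} (hr' : IsExitPoint F g r') {k : ℕ} {s : ℝ}
    (hs : 0 ≤ s) (hs1 : s ≤ 1) (h : r = pathPoint F k s f) (h1 : ‖r‖ = 1)
    (hfg : ‖pathPoint F k s f - pathPoint F k s g‖ ≤ δ) : ‖r - r'‖ ≤ δ + 3 * ε := by
  rw [← h] at hfg
  have key : ‖pathPoint F k s g - r'‖ ≤ 3 * ε := by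
    rcases hF.precedes_or_precedes hε hE hr' k hs hs1 with hp | ⟨hp, hn⟩
    · refine hp.2 (by linarith [hr'.norm_le]) ?_
      have := norm_sub_norm_le r (pathPoint F k s g)
      linarith
    · rw [norm_sub_rev]
      refine hp.2 ?_ (by linarith)
      have := norm_sub_norm_le (pathPoint F k s g) r
      rw [norm_sub_rev] at this
      linarith
  calc ‖r - r'‖ = ‖(r - pathPoint F k s g) + (pathPoint F k s g - r')‖ := by congr 1; abel
    _ ≤ _ := (norm_add_le _ _).trans (add_le_add hfg key)

theorem norm_pathPoint_sub_le {η C : ℝ} (hη : 0 ≤ η) (hC0 : 0 ≤ C) (hC : ContinuityEstimate F η C)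
    {f g : StrongDual 𝕜 X} {k : ℕ} {s : ℝ} (hs : 0 ≤ s) (hs1 : s ≤ 1)
    (h : ‖pathPoint F k s f‖ ≤ 1) :
    ‖pathPoint F k s f - pathPoint F k s g‖ ≤ 3 * η + 2 * C * ‖f - g‖ := by
  have h0 : ‖F k f‖ ≤ 1 := by
    refine le_trans ?_ h
    have := hF.norm_le k (F (k + 1) f) s hs hs1
    rwa [hF.comp k (k + 1) (Nat.le_succ k)] at this
  have hk := hC k f g
  have hk1 := hC (k + 1) f g
  have hs1' : 0 ≤ 1 - s := by linarith
  -- `F (k + 1) f` may be far outside the ball; only its weighted contribution to the path point is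
  -- bounded.
  have h1 : s * ‖F (k + 1) f‖ ≤ 2 := by
    have e : s • F (k + 1) f = pathPoint F k s f - (1 - s) • F k f := by
      simp [pathPoint]
    calc s * ‖F (k + 1) f‖ = ‖s • F (k + 1) f‖ := by rw [norm_smul, Real.norm_of_nonneg hs]
      _ ≤ ‖pathPoint F k s f‖ + (1 - s) * ‖F k f‖ := by
        rw [e]
        refine (norm_sub_le _ _).trans ?_
        rw [norm_smul (1 - s), Real.norm_of_nonneg hs1']
      _ ≤ 2 := by nlinarith [norm_nonneg (F k f)]
  have e : pathPoint F k s f - pathPoint F k s g =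
      (1 - s) • (F k f - F k g) + s • (F (k + 1) f - F (k + 1) g) := by
    simp only [pathPoint]; module
  have h2 : ‖pathPoint F k s f - pathPoint F k s g‖ ≤
      (1 - s) * ‖F k f - F k g‖ + s * ‖F (k + 1) f - F (k + 1) g‖ := by
    rw [e]
    refine (norm_add_le _ _).trans ?_
    rw [norm_smul, norm_smul, Real.norm_of_nonneg hs, Real.norm_of_nonneg hs1']
  have hd := norm_nonneg (f - g)
  have h3 : (1 - s) * ‖F k f - F k g‖ ≤ 1 * (η * 1 + C * ‖f - g‖) := by
    refine mul_le_mul (by linarith) (hk.trans ?_) (norm_nonneg _) zero_le_one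
    gcongr
  have h4 : s * ‖F (k + 1) f - F (k + 1) g‖ ≤ η * 2 + C * ‖f - g‖ := by
    calc s * ‖F (k + 1) f - F (k + 1) g‖ ≤ s * (η * ‖F (k + 1) f‖ + C * ‖f - g‖) := by gcongr
      _ = η * (s * ‖F (k + 1) f‖) + s * (C * ‖f - g‖) := by ring
      _ ≤ η * 2 + 1 * (C * ‖f - g‖) := by gcongr
      _ = _ := by ring
  linarith

/-- A map of the dual into its unit ball which moves `f` to an exit point of its path. -/
noncomputable def exitMap (f : StrongDual 𝕜 X) : StrongDual 𝕜 X :=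
  Classical.choose (hF.exists_isExitPoint f)

theorem isExitPoint_exitMap (f : StrongDual 𝕜 X) : IsExitPoint F f (hF.exitMap f) :=
  Classical.choose_spec (hF.exists_isExitPoint f)

theorem norm_exitMap_le (f : StrongDual 𝕜 X) : ‖hF.exitMap f‖ ≤ 1 :=
  (hF.isExitPoint_exitMap f).norm_le

theorem exitMap_eq_self {f : StrongDual 𝕜 X} (hf : ‖f‖ ≤ 1) : hF.exitMap f = f :=
  hF.isExitPoint_eq_self (hF.isExitPoint_exitMap f) hf

theorem norm_exitMap_sub_le {ε δ η C : ℝ} (hε : 0 ≤ ε) (hδ : 0 ≤ δ) (hδε : δ ≤ ε)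
    (hE : SegmentEstimate F ε δ) (hη : 0 ≤ η) (hC0 : 0 ≤ C) (hC : ContinuityEstimate F η C)
    {f g : StrongDual 𝕜 X} (hfg : 3 * η + 2 * C * ‖f - g‖ ≤ δ) (hfg' : ‖f - g‖ ≤ δ) :
    ‖hF.exitMap f - hF.exitMap g‖ ≤ 4 * ε := by
  have hf := hF.isExitPoint_exitMap f
  have hg := hF.isExitPoint_exitMap g
  rcases id hf with ⟨k, s, hs, hs1, h, h1, -⟩ | ⟨h, -⟩
  · have := hF.norm_isExitPoint_sub_le hε hδ hE hg hs hs1 h h1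
      ((hF.norm_pathPoint_sub_le hη hC0 hC hs hs1 (by rw [← h, h1])).trans hfg)
    linarith
  · rcases id hg with ⟨k, s, hs, hs1, h', h1, -⟩ | ⟨h', -⟩
    · rw [norm_sub_rev] at hfg ⊢
      have := hF.norm_isExitPoint_sub_le hε hδ hE hf hs hs1 h' h1
        ((hF.norm_pathPoint_sub_le hη hC0 hC hs hs1 (by rw [← h', h1])).trans hfg)
      linarith
    · rw [h, h']; linarith

theorem continuous_pathPoint (k : ℕ) (s : ℝ) :
    Continuous fun f : WeakDual 𝕜 X => pathPoint F k s (WeakDual.toStrongDual f) :=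
  ((hF.continuous k).const_smul (1 - s)).add ((hF.continuous (k + 1)).const_smul s)

theorem tendsto_exitMap_apply (hE : ∀ ε : ℝ, 0 < ε → ∃ δ, 0 < δ ∧ SegmentEstimate F ε δ)
    {x : X} (hx : x ∈ stableSubmodule F) (f : WeakDual 𝕜 X) :
    Tendsto (fun g : WeakDual 𝕜 X => hF.exitMap (WeakDual.toStrongDual g) x) (𝓝 f)
      (𝓝 (hF.exitMap (WeakDual.toStrongDual f) x)) := by
  obtain ⟨n, hn⟩ := hx
  rw [Metric.tendsto_nhds]
  intro ε hε
  -- Functionals within `4 * (ε / (2 * c))` differ by at most `ε / 2` at `x`.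
  set c := 4 * (‖x‖ + 1) with hc
  have hc0 : 0 < c := by positivity
  have hcε : ∀ L : StrongDual 𝕜 X, ‖L‖ ≤ 4 * (ε / (2 * c)) → ‖L x‖ ≤ ε / 2 := fun L hL => by
    calc ‖L x‖ ≤ 4 * (ε / (2 * c)) * ‖x‖ := L.le_of_opNorm_le hL x
      _ ≤ 4 * (ε / (2 * c)) * (‖x‖ + 1) := by gcongr; linarith
      _ = ε / 2 := by rw [hc]; field_simp
  have hε' : 0 < ε / (2 * c) := by positivity
  obtain ⟨δ', hδ', hE'⟩ := hE _ hε'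
  obtain ⟨δ, hδ, hδε, hE⟩ : ∃ δ, 0 < δ ∧ δ ≤ ε / (2 * c) ∧ SegmentEstimate F (ε / (2 * c)) δ := by
    refine ⟨min δ' (ε / (2 * c)), lt_min hδ' hε', min_le_right _ _, ?_⟩
    intro n g s t hs hst ht h1 h2
    exact hE' n g s t hs hst ht (h1.trans (by linarith [min_le_left δ' (ε / (2 * c))]))
      (le_trans (by linarith [min_le_left δ' (ε / (2 * c))]) h2)
  rcases hF.isExitPoint_exitMap (WeakDual.toStrongDual f) with ⟨k, s, hs, hs1, h, h1, -⟩ | ⟨h, h1⟩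
  -- If the path of `f` exits on a segment, that path point moves little in norm when `f` moves
  -- weak-*.
  · have := Metric.tendsto_nhds.1 ((hF.continuous_pathPoint k s).tendsto f) δ hδ
    filter_upwards [this] with g hg
    rw [dist_comm, dist_eq_norm] at hg ⊢
    refine (hcε (_ - _) ?_).trans_lt (by linarith)
    have := hF.norm_isExitPoint_sub_le hε'.le hδ.le hE
      (hF.isExitPoint_exitMap (WeakDual.toStrongDual g)) hs hs1 h h1 hg.le
    linarith
  -- If `f` is in the ball, `g` may exit anywhere. Before stage `n`, its exit point is near `F n g`,
  -- whose norm is at most `1 + δ`; from stage `n` on, all path points agree with `g` at `x`.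
  · have hev := Metric.tendsto_nhds.1 ((hF.continuous_pathPoint n 0).tendsto f) δ hδ
    have hev' := Metric.tendsto_nhds.1 ((WeakDual.eval_continuous x).tendsto f) (ε / 2)
      (by positivity)
    filter_upwards [hev, hev'] with g hg hg'
    simp only [pathPoint_zero] at hg
    have hgn : ‖F n (WeakDual.toStrongDual g)‖ ≤ 1 + δ := by
      have h2 := norm_sub_norm_le (F n (WeakDual.toStrongDual g)) (F n (WeakDual.toStrongDual f))
      rw [← dist_eq_norm] at h2
      linarith [hF.norm_apply_le n (WeakDual.toStrongDual f)]
    have key : ‖hF.exitMap (WeakDual.toStrongDual g) x - WeakDual.toStrongDual g x‖ ≤ ε / 2 := by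
      rcases hF.isExitPoint_exitMap (WeakDual.toStrongDual g) with
        ⟨k, s, hs, hs1, hr, hr1, -⟩ | ⟨hr, -⟩
      · rcases lt_or_ge k n with hkn | hkn
        · have hp := hF.precedes_pathPoint_of_lt hE hkn (WeakDual.toStrongDual g) hs hs1 le_rfl
            zero_le_one
          rw [← hr, pathPoint_zero] at hp
          have h2 := hp.2 hgn (by linarith)
          have h3 : ‖hF.exitMap (WeakDual.toStrongDual g) - F n (WeakDual.toStrongDual g)‖ ≤
            4 * (ε / (2 * c)) := h2.trans (by linarith)
          rw [← hn n le_rfl (WeakDual.toStrongDual g)]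
          exact hcε _ h3
        · have : hF.exitMap (WeakDual.toStrongDual g) x = WeakDual.toStrongDual g x := by
            rw [hr]
            simp only [pathPoint, add_apply, smul_apply, hn k hkn, hn (k + 1) (hkn.trans k.le_succ)]
            module
          rw [this, sub_self, norm_zero]
          positivity
      · rw [hr, sub_self, norm_zero]
        positivity
    rw [h]
    refine (dist_triangle _ (g x) _).trans_lt ?_
    rw [dist_eq_norm]
    exact (add_lt_add_of_le_of_lt key hg').trans_le (by linarith)

/-- Stable vectors are dense and the values of `exitMap` lie in the unit ball, so continuity passes
to all `x`. -/
theorem continuous_exitMap (hE : ∀ ε : ℝ, 0 < ε → ∃ δ, 0 < δ ∧ SegmentEstimate F ε δ) :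
    Continuous fun f : WeakDual 𝕜 X =>
      StrongDual.toWeakDual (hF.exitMap (WeakDual.toStrongDual f)) := by
  refine WeakDual.continuous_of_continuous_eval fun x => ?_
  rw [continuous_iff_continuousAt]
  intro f
  rw [ContinuousAt, Metric.tendsto_nhds]
  intro ε hε
  obtain ⟨y, hy, hxy⟩ := Metric.dense_iff.1 hF.dense x (ε / 3) (by positivity)
  have hb : ∀ g : StrongDual 𝕜 X, ‖hF.exitMap g x - hF.exitMap g y‖ < ε / 3 := fun g => by
    rw [← map_sub]
    refine ((hF.exitMap g).le_of_opNorm_le (hF.norm_exitMap_le g) _).trans_lt ?_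
    rw [one_mul, ← dist_eq_norm, dist_comm]
    exact hy
  filter_upwards [Metric.tendsto_nhds.1 (hF.tendsto_exitMap_apply hE hxy f) (ε / 3)
    (by positivity)] with g hg
  have h1 := hb (WeakDual.toStrongDual g)
  have h2 := hb (WeakDual.toStrongDual f)
  rw [← dist_eq_norm] at h1 h2
  rw [dist_comm] at h2
  refine (dist_triangle4 _ _ _ _).trans_lt ((add_lt_add (add_lt_add h1 hg) h2).trans_le ?_)
  linarith

end ApproximationScheme

/-- Stated for families because the ℓ_1-sum needs one modulus `ρ` for all summands. -/
theorem exists_uniform_retraction {ι : Type*} {X : ι → Type*} [∀ i, NormedAddCommGroup (X i)]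
    [∀ i, NormedSpace 𝕜 (X i)] {F : ∀ i, ℕ → StrongDual 𝕜 (X i) → StrongDual 𝕜 (X i)}
    (hF : ∀ i, ApproximationScheme (F i))
    (hE : ∀ ε : ℝ, 0 < ε → ∃ δ, 0 < δ ∧ ∀ i, SegmentEstimate (F i) ε δ)
    (hC : ∀ ε : ℝ, 0 < ε → ∃ C, 0 < C ∧ ∀ i, ContinuityEstimate (F i) ε C) :
    ∃ r : ∀ i, StrongDual 𝕜 (X i) → StrongDual 𝕜 (X i),
      (∀ i f, ‖r i f‖ ≤ 1) ∧ (∀ i f, ‖f‖ ≤ 1 → r i f = f) ∧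
      (∀ ε : ℝ, 0 < ε → ∃ ρ : ℝ, 0 < ρ ∧ ∀ i f g, ‖f - g‖ ≤ ρ → ‖r i f - r i g‖ ≤ ε) ∧
      ∀ i, Continuous fun f : WeakDual 𝕜 (X i) =>
        StrongDual.toWeakDual (r i (WeakDual.toStrongDual f)) := by
  refine ⟨fun i => (hF i).exitMap, fun i f => (hF i).norm_exitMap_le f,
    fun i f => (hF i).exitMap_eq_self, fun ε hε => ?_, fun i => (hF i).continuous_exitMap
      fun ε hε => (hE ε hε).imp fun δ h => ⟨h.1, h.2 i⟩⟩
  obtain ⟨δ', hδ', hE'⟩ := hE (ε / 4) (by positivity)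
  set δ := min δ' (ε / 4) with hδ
  have hδ0 : 0 < δ := by positivity
  -- With this constant and `‖f - g‖ ≤ δ / (4 * C)`, both terms of `3 * η + 2 * C * ‖f - g‖` are at
  -- most `δ / 2`.
  obtain ⟨C, hC0, hC⟩ := hC (δ / 6) (by positivity)
  refine ⟨min δ (δ / (4 * C)), by positivity, fun i f g hfg => ?_⟩
  have hE'' : SegmentEstimate (F i) (ε / 4) δ := fun n g s t hs hst ht h1 h2 =>
    hE' i n g s t hs hst ht (h1.trans (by linarith [min_le_left δ' (ε / 4)]))
      (le_trans (by linarith [min_le_left δ' (ε / 4)]) h2)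
  have h1 : 2 * C * ‖f - g‖ ≤ δ / 2 := by
    have := hfg.trans (min_le_right _ _)
    rw [le_div_iff₀ (by positivity)] at this
    linarith
  have := (hF i).norm_exitMap_sub_le (by positivity) hδ0.le (min_le_right _ _) hE''
    (by positivity) hC0.le (hC i) (f := f) (g := g) (by linarith) (hfg.trans (min_le_left _ _))
  linarith

end Retraction

/-! ### Separability and finite-dimensional exhaustions -/

theorem separableSpace_of_dual (𝕜 : Type*) [RCLike 𝕜] (X : Type*) [NormedAddCommGroup X]
    [NormedSpace 𝕜 X] [TopologicalSpace.SeparableSpace (StrongDual 𝕜 X)] :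
    TopologicalSpace.SeparableSpace X := by
  let f := TopologicalSpace.denseSeq (StrongDual 𝕜 X)
  have hx : ∀ n, ∃ x : X, ‖x‖ ≤ 1 ∧ ‖f n‖ ≤ 2 * ‖f n x‖ := fun n => by
    rcases eq_or_ne (f n) 0 with h | h
    · exact ⟨0, by simp, by simp [h]⟩
    · obtain ⟨x, hx, hx'⟩ := (f n).exists_lt_apply_of_lt_opNorm
        (half_lt_self (norm_pos_iff.2 h))
      exact ⟨x, hx.le, by linarith⟩
  choose x hx1 hx using hx
  have hd : (Submodule.span 𝕜 (Set.range x)).topologicalClosure = ⊤ := by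
    by_contra hcon
    obtain ⟨y, hy⟩ : ∃ y, y ∉ (Submodule.span 𝕜 (Set.range x)).topologicalClosure := by
      by_contra! h
      exact hcon (eq_top_iff.2 fun y _ => h y)
    obtain ⟨g, hg, hgy⟩ : ∃ g : StrongDual 𝕜 X, (∀ n, g (x n) = 0) ∧ g ≠ 0 := by
      set S := (Submodule.span 𝕜 (Set.range x)).topologicalClosure with hS
      have : IsClosed (S : Set X) := Submodule.isClosed_topologicalClosure _
      have hy0 : (S.mkQ y : X ⧸ S) ≠ 0 := by simpa using hy
      obtain ⟨g, -, hg⟩ := exists_dual_vector 𝕜 (S.mkQ y) (norm_ne_zero_iff.2 hy0)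
      refine ⟨g.comp S.mkQL, fun n => ?_, fun h => ?_⟩
      · have hxn : S.mkQ (x n) = 0 := by
          simpa using Submodule.le_topologicalClosure _ 
            (Submodule.subset_span (Set.mem_range_self (f := x) n))
        exact (congrArg g hxn).trans (map_zero g)
      · have h1 : g (S.mkQ y) = 0 := DFunLike.congr_fun h y
        rw [h1] at hg
        exact hy0 (norm_eq_zero.1 (by exact_mod_cast hg.symm))
    -- Since `g` kills `x n`, `‖f n‖ ≤ 2 * ‖g - f n‖`, so `‖g‖ ≤ 3 * ‖g - f n‖ < ‖g‖`.
    obtain ⟨n, hn⟩ := (TopologicalSpace.denseRange_denseSeq (StrongDual 𝕜 X)).exists_dist_lt g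
      (show 0 < ‖g‖ / 4 by have := norm_pos_iff.2 hgy; positivity)
    rw [dist_eq_norm] at hn
    have h1 : ‖f n (x n)‖ ≤ ‖g - f n‖ := by
      have := (g - f n).le_of_opNorm_le_of_le le_rfl (hx1 n)
      simpa [hg n] using this
    have h2 : ‖g‖ ≤ ‖g - f n‖ + ‖f n‖ := by simpa using norm_add_le (g - f n) (f n)
    change ‖g - f n‖ < _ at hn
    linarith [hx n, norm_pos_iff.2 hgy]
  have hs : TopologicalSpace.IsSeparable (Submodule.span 𝕜 (Set.range x) : Set X) :=
    (Set.countable_range x).isSeparable.span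
  have hc := hs.closure
  rw [← Submodule.topologicalClosure_coe, hd] at hc
  exact TopologicalSpace.isSeparable_univ_iff.1 hc

theorem exists_exhaustion (𝕜 : Type*) [RCLike 𝕜] (X : Type*) [NormedAddCommGroup X]
    [NormedSpace 𝕜 X] [TopologicalSpace.SeparableSpace X] :
    ∃ G : ℕ → Submodule 𝕜 X, G 0 = ⊥ ∧ Monotone G ∧ (∀ n, FiniteDimensional 𝕜 (G n)) ∧
      Dense (⋃ n, (G n : Set X)) := by
  -- The strict inequality `j < n` makes the first subspace trivial, so that paths start at 0.
  refine ⟨fun n => Submodule.span 𝕜 (TopologicalSpace.denseSeq X '' {j | j < n}), by simp,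
    fun n m h => Submodule.span_mono (Set.image_mono fun j hj => lt_of_lt_of_le hj h),
    fun n => FiniteDimensional.span_of_finite 𝕜 ((Set.finite_lt_nat n).image _), ?_⟩
  refine (TopologicalSpace.denseRange_denseSeq X).mono ?_
  rintro _ ⟨j, rfl⟩
  exact Set.mem_iUnion.2 ⟨j + 1, Submodule.subset_span ⟨j, Nat.lt_succ_self j, rfl⟩⟩

/-! ### Minimal extensions in a single space -/

section SingleSpace

variable {𝕜 : Type*} [RCLike 𝕜] {X : Type*} [NormedAddCommGroup X] [NormedSpace 𝕜 X]

theorem approximationScheme_minExt (h : ∀ ε : ℝ, 0 < ε → ∃ C, 0 < C ∧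
      ConvexityEstimate (StrongDual 𝕜 X) ε C) {G : ℕ → Submodule 𝕜 X} (h0 : G 0 = ⊥)
    (hG : Monotone G) (hfd : ∀ n, FiniteDimensional 𝕜 (G n)) (hd : Dense (⋃ n, (G n : Set X))) :
    ApproximationScheme fun n => minExt (G n) where
  zero f := by rw [h0, minExt_bot]
  comp n m hnm f := minExt_minExt (hG hnm) f
  norm_le n g s _ _ := norm_minExt_le_segment (G n) g s
  continuous n := continuous_minExt h (G n)
  dense := by
    refine hd.mono (Set.iUnion_subset fun n x hx => ⟨n, fun m hm f => ?_⟩)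
    exact minExt_apply _ _ (hG hm hx)

/-- The bound 1 on `δ` keeps `‖v‖ ≤ 2`, and the norms differ by at most `2 * δ`; each of the two
error terms is then at most `ε / 2`. -/
theorem segmentEstimate_minExt {ε C : ℝ} (hC0 : 0 < C) (hε : 0 < ε)
    (hC : ConvexityEstimate (StrongDual 𝕜 X) (ε / 4) C) (G : ℕ → Submodule 𝕜 X) :
    SegmentEstimate (fun n => minExt (G n)) ε (min 1 (ε / (8 * C))) := by
  intro n g s t hs hst ht h1 h2
  refine (hC.norm_segment_sub_le hC0.le (fun s _ _ => norm_minExt_le_segment (G n) g s) hs hst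
    ht).trans ?_
  have h3 := min_le_left 1 (ε / (8 * C))
  have h4 : 4 * C * min 1 (ε / (8 * C)) ≤ ε / 2 := by
    have := min_le_right 1 (ε / (8 * C))
    rw [le_div_iff₀ (by positivity)] at this
    linarith
  nlinarith

theorem continuityEstimate_minExt {ε C : ℝ} (hε : 0 ≤ ε) (hC0 : 0 ≤ C)
    (hC : ConvexityEstimate (StrongDual 𝕜 X) ε C) (G : ℕ → Submodule 𝕜 X) :
    ContinuityEstimate (fun n => minExt (G n)) ε (ε + 3 * C) := fun n f g =>
  (hC.norm_minExt_sub_le hC0 (G n) f g).trans (add_le_add_right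
    (mul_le_mul_of_nonneg_left (norm_comp_subtypeL_le _ _) (by positivity)) _)

end SingleSpace

/-! ### Sums whose dual is an ℓ_q-sum -/

/-- `Z` is a sum of the spaces `X i`, with the embeddings `e i` and the projections `π i`, such that
the dual of `Z` is an `ℓ_q`-sum of the duals of the `X i`. -/
structure IsDualLpSum {𝕜 : Type*} [RCLike 𝕜] {X : ℕ → Type*} [∀ i, NormedAddCommGroup (X i)]
    [∀ i, NormedSpace 𝕜 (X i)] {Z : Type*} [NormedAddCommGroup Z] [NormedSpace 𝕜 Z]
    (e : ∀ i, X i →L[𝕜] Z) (π : ∀ i, Z →L[𝕜] X i) (q : ℝ) : Prop where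
  proj_self : ∀ i x, π i (e i x) = x
  proj_ne : ∀ i j, i ≠ j → ∀ x, π i (e j x) = 0
  hasSum : ∀ z, HasSum (fun i => e i (π i z)) z
  hasSum_norm : ∀ f : StrongDual 𝕜 Z, HasSum (fun i => ‖f.comp (e i)‖ ^ q) (‖f‖ ^ q)

namespace IsDualLpSum

variable {𝕜 : Type*} [RCLike 𝕜] {X : ℕ → Type*} [∀ i, NormedAddCommGroup (X i)]
  [∀ i, NormedSpace 𝕜 (X i)] {Z : Type*} [NormedAddCommGroup Z] [NormedSpace 𝕜 Z]
  {e : ∀ i, X i →L[𝕜] Z} {π : ∀ i, Z →L[𝕜] X i} {q : ℝ} (hZ : IsDualLpSum e π q)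
include hZ

theorem ext {f g : StrongDual 𝕜 Z} (h : ∀ i, f.comp (e i) = g.comp (e i)) : f = g := by
  ext z
  refine ((hZ.hasSum z).mapL f).unique ?_
  have := (hZ.hasSum z).mapL g
  refine this.congr_fun fun i => ?_
  exact DFunLike.congr_fun (h i) (π i z)

theorem norm_le_norm (hq : 1 ≤ q) {f g : StrongDual 𝕜 Z}
    (h : ∀ i, ‖f.comp (e i)‖ ≤ ‖g.comp (e i)‖) : ‖f‖ ≤ ‖g‖ := by
  have hq0 : 0 < q := by linarith
  rw [← Real.rpow_le_rpow_iff (norm_nonneg _) (norm_nonneg _) hq0]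
  exact hasSum_le (fun i => Real.rpow_le_rpow (norm_nonneg _) (h i) hq0.le) (hZ.hasSum_norm f)
    (hZ.hasSum_norm g)

/-- Minkowski's inequality in ℓ_q. The numbers `b i` need not be coordinate norms of a functional:
they will also be differences of such norms. -/
theorem norm_le_add (hq : 1 ≤ q) {ε C B : ℝ} (hε : 0 ≤ ε) (hC : 0 ≤ C) (hB : 0 ≤ B)
    {h u : StrongDual 𝕜 Z} {b : ℕ → ℝ} (hb : ∀ i, 0 ≤ b i) (hs : Summable fun i => b i ^ q)
    (hbB : ∑' i, b i ^ q ≤ B ^ q)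
    (H : ∀ i, ‖h.comp (e i)‖ ≤ ε * ‖u.comp (e i)‖ + C * b i) : ‖h‖ ≤ ε * ‖u‖ + C * B := by
  have hq0 : 0 < q := by linarith
  set B' := (∑' i, b i ^ q) ^ q⁻¹ with hB'
  have ht : 0 ≤ ∑' i, b i ^ q := tsum_nonneg fun i => Real.rpow_nonneg (hb i) q
  have hB0 : 0 ≤ B' := Real.rpow_nonneg ht _
  have hB'q : B' ^ q = ∑' i, b i ^ q := Real.rpow_inv_rpow ht hq0.ne'
  have hBB : B' ≤ B := by rwa [← Real.rpow_le_rpow_iff hB0 hB hq0, hB'q]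
  obtain ⟨D, hD0, hD, hDs⟩ := Real.Lp_add_le_hasSum_of_nonneg hq
    (f := fun i => ε * ‖u.comp (e i)‖) (g := fun i => C * b i) (A := ε * ‖u‖) (B := C * B')
    (fun i => by positivity) (fun i => mul_nonneg hC (hb i)) (by positivity) (by positivity)
    (by
      simp only [Real.mul_rpow hε (norm_nonneg _)]
      exact (hZ.hasSum_norm u).mul_left _)
    (by
      rw [Real.mul_rpow hC hB0, hB'q]
      simp only [Real.mul_rpow hC (hb _)]
      exact hs.hasSum.mul_left _)
  have h1 : ‖h‖ ≤ D := by
    rw [← Real.rpow_le_rpow_iff (norm_nonneg _) hD0 hq0]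
    exact hasSum_le (fun i => Real.rpow_le_rpow (norm_nonneg _) (H i) hq0.le) (hZ.hasSum_norm h) hDs
  exact h1.trans (hD.trans (by gcongr))

end IsDualLpSum

/-- The functional which on the first `n` summands is the extension of minimal norm of the
restriction of `f` to a subspace, and which vanishes on the other summands. -/
noncomputable def sumMinExt {𝕜 : Type*} [RCLike 𝕜] {X : ℕ → Type*} [∀ i, NormedAddCommGroup (X i)]
    [∀ i, NormedSpace 𝕜 (X i)] {Z : Type*} [NormedAddCommGroup Z] [NormedSpace 𝕜 Z]
    (e : ∀ i, X i →L[𝕜] Z) (π : ∀ i, Z →L[𝕜] X i) (G : ∀ i, ℕ → Submodule 𝕜 (X i)) (n : ℕ)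
    (f : StrongDual 𝕜 Z) : StrongDual 𝕜 Z :=
  ∑ i ∈ Finset.range n, (minExt (G i (n - i)) (f.comp (e i))).comp (π i)

namespace IsDualLpSum

variable {𝕜 : Type*} [RCLike 𝕜] {X : ℕ → Type*} [∀ i, NormedAddCommGroup (X i)]
  [∀ i, NormedSpace 𝕜 (X i)] {Z : Type*} [NormedAddCommGroup Z] [NormedSpace 𝕜 Z]
  {e : ∀ i, X i →L[𝕜] Z} {π : ∀ i, Z →L[𝕜] X i} {q : ℝ} (hZ : IsDualLpSum e π q)
  {G : ∀ i, ℕ → Submodule 𝕜 (X i)}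
include hZ

/-- Truncated subtraction gives `n - j = 0` for `j ≥ n`, where `G j 0 = ⊥` produces the zero
functional; one formula covers all coordinates. -/
theorem sumMinExt_comp (h0 : ∀ i, G i 0 = ⊥) (n : ℕ) (f : StrongDual 𝕜 Z) (j : ℕ) :
    (sumMinExt e π G n f).comp (e j) = minExt (G j (n - j)) (f.comp (e j)) := by
  ext x
  have hne : ∀ i ∈ Finset.range n, i ≠ j →
      (minExt (G i (n - i)) (f.comp (e i))) (π i (e j x)) = 0 := fun i _ hij => by
    simp [hZ.proj_ne i j hij]
  simp only [sumMinExt, ContinuousLinearMap.comp_apply, sum_apply]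
  rcases lt_or_ge j n with hj | hj
  · rw [Finset.sum_eq_single_of_mem j (Finset.mem_range.2 hj) hne, hZ.proj_self]
  · rw [Finset.sum_eq_zero fun i hi => hne i hi (by have := Finset.mem_range.1 hi; omega),
      Nat.sub_eq_zero_of_le hj, h0, minExt_bot]
    rfl

theorem approximationScheme (hq : 1 ≤ q) (h : ∀ i, ∀ ε : ℝ, 0 < ε → ∃ C, 0 < C ∧
      ConvexityEstimate (StrongDual 𝕜 (X i)) ε C) (h0 : ∀ i, G i 0 = ⊥)
    (hG : ∀ i, Monotone (G i)) (hfd : ∀ i n, FiniteDimensional 𝕜 (G i n))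
    (hd : ∀ i, Dense (⋃ n, (G i n : Set (X i)))) :
    ApproximationScheme (sumMinExt e π G) where
  zero f := by simp [sumMinExt]
  comp n m hnm f := hZ.ext fun i => by
    rw [hZ.sumMinExt_comp h0, hZ.sumMinExt_comp h0, hZ.sumMinExt_comp h0]
    exact minExt_minExt (hG i (Nat.sub_le_sub_right hnm i)) _
  norm_le n g s _ _ := hZ.norm_le_norm hq fun i => by
    rw [ContinuousLinearMap.add_comp, ContinuousLinearMap.smul_comp, ContinuousLinearMap.smul_comp,
      hZ.sumMinExt_comp h0]
    exact norm_minExt_le_segment _ _ s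
  continuous n := by
    refine continuous_finsetSum _ fun i _ => ?_
    have h1 : Continuous fun f : WeakDual 𝕜 Z =>
        StrongDual.toWeakDual ((WeakDual.toStrongDual f).comp (e i)) :=
      WeakDual.continuous_of_continuous_eval fun x => WeakDual.eval_continuous (e i x)
    exact ((continuous_minExt (h i) (G i (n - i))).comp h1).clm_comp continuous_const
  dense := by
    set S := stableSubmodule (sumMinExt e π G) with hS
    -- Coordinate `i` uses the subspace `G i (m - i)`, which contains `G i n` once `m ≥ n + i`.
    have hmem : ∀ i n, ∀ x ∈ G i n, e i x ∈ S := fun i n x hx => by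
      refine ⟨n + i, fun m hm f => ?_⟩
      have := DFunLike.congr_fun (hZ.sumMinExt_comp h0 m f i) x
      rw [ContinuousLinearMap.comp_apply, minExt_apply _ _ (hG i (by omega : n ≤ m - i) hx)] at this
      exact this
    have hcl : ∀ i x, e i x ∈ S.topologicalClosure := fun i x => by
      refine (hd i).induction (P := fun x => e i x ∈ S.topologicalClosure) ?_
        (S.isClosed_topologicalClosure.preimage (e i).continuous) x
      intro x hx
      obtain ⟨n, hn⟩ := Set.mem_iUnion.1 hx
      exact S.le_topologicalClosure (hmem i n x hn)
    intro z
    rw [← Submodule.topologicalClosure_coe]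
    exact S.isClosed_topologicalClosure.mem_of_tendsto (hZ.hasSum z)
      (Eventually.of_forall fun s => Submodule.sum_mem _ fun i _ => hcl i _)

theorem continuityEstimate (hq : 1 ≤ q) {ε C : ℝ} (hε : 0 ≤ ε) (hC0 : 0 ≤ C)
    (hC : ∀ i, ConvexityEstimate (StrongDual 𝕜 (X i)) ε C) (h0 : ∀ i, G i 0 = ⊥) :
    ContinuityEstimate (sumMinExt e π G) ε (ε + 3 * C) := fun n f g => by
  refine hZ.norm_le_add hq hε (by positivity) (norm_nonneg _) (fun i => norm_nonneg _)
    (hZ.hasSum_norm (f - g)).summable (hZ.hasSum_norm (f - g)).tsum_eq.le fun i => ?_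
  rw [ContinuousLinearMap.sub_comp, ContinuousLinearMap.sub_comp, hZ.sumMinExt_comp h0,
    hZ.sumMinExt_comp h0]
  exact continuityEstimate_minExt hε hC0 (hC i) (fun _ => G i (n - i)) 0 _ _

/-- Coordinate norms increase along the segment, so `(b - a) ^ q ≤ b ^ q - a ^ q` sums to at most
`(1 + δ) ^ q - (1 - δ) ^ q`. The ℓ_q-norm of the increments is thus small, and Minkowski's
inequality combines the coordinate estimates. -/
theorem exists_segmentEstimate (hq : 1 ≤ q) {ε C : ℝ} (hε : 0 < ε) (hC0 : 0 < C)
    (hC : ∀ i, ConvexityEstimate (StrongDual 𝕜 (X i)) (ε / 4) C) (h0 : ∀ i, G i 0 = ⊥) :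
    ∃ δ, 0 < δ ∧ SegmentEstimate (sumMinExt e π G) ε δ := by
  have hq0 : 0 < q := by linarith
  obtain ⟨δ, ⟨hδ, hδ1⟩, hδ0⟩ : ∃ δ : ℝ, ((1 + δ) ^ q - (1 - δ) ^ q < (ε / (4 * C)) ^ q ∧ δ < 1) ∧
      0 < δ := by
    have hc : Continuous fun δ : ℝ => (1 + δ) ^ q - (1 - δ) ^ q :=
      ((continuous_const.add continuous_id).rpow_const fun _ => Or.inr hq0.le).sub
        ((continuous_const.sub continuous_id).rpow_const fun _ => Or.inr hq0.le)
    have h1 : ∀ᶠ δ : ℝ in 𝓝 0, (1 + δ) ^ q - (1 - δ) ^ q < (ε / (4 * C)) ^ q :=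
      (hc.tendsto 0).eventually_lt_const (by simp; positivity)
    have h2 : ∀ᶠ δ : ℝ in 𝓝[>] 0, ((1 + δ) ^ q - (1 - δ) ^ q < (ε / (4 * C)) ^ q ∧ δ < 1) ∧ 0 < δ :=
      ((h1.and (eventually_lt_nhds one_pos)).filter_mono nhdsWithin_le_nhds).and
        self_mem_nhdsWithin
    exact h2.exists
  refine ⟨δ, hδ0, fun n g s t hs hst ht h1 h2 => ?_⟩
  set u := (1 - s) • sumMinExt e π G n g + s • g with hu
  set v := (1 - t) • sumMinExt e π G n g + t • g with hv
  have hcoord : ∀ (s : ℝ) i, ((1 - s) • sumMinExt e π G n g + s • g).comp (e i) =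
      (1 - s) • minExt (G i (n - i)) (g.comp (e i)) + s • g.comp (e i) := fun s i => by
    rw [ContinuousLinearMap.add_comp, ContinuousLinearMap.smul_comp, ContinuousLinearMap.smul_comp,
      hZ.sumMinExt_comp h0]
  have hmono : ∀ i, ‖u.comp (e i)‖ ≤ ‖v.comp (e i)‖ := fun i => by
    rw [hu, hv, hcoord, hcoord]
    exact norm_segment_mono (fun s _ _ => norm_minExt_le_segment _ _ s) hs hst ht
  have hle : ∀ i, (‖v.comp (e i)‖ - ‖u.comp (e i)‖) ^ q ≤
      ‖v.comp (e i)‖ ^ q - ‖u.comp (e i)‖ ^ q := fun i => by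
    have := Real.add_rpow_le_rpow_add (sub_nonneg.2 (hmono i)) (norm_nonneg (u.comp (e i))) hq
    rw [sub_add_cancel] at this
    linarith
  have hsum := (hZ.hasSum_norm v).sub (hZ.hasSum_norm u)
  have hs' : Summable fun i => (‖v.comp (e i)‖ - ‖u.comp (e i)‖) ^ q :=
    Summable.of_nonneg_of_le (fun i => Real.rpow_nonneg (sub_nonneg.2 (hmono i)) _) hle hsum.summable
  have hB : ∑' i, (‖v.comp (e i)‖ - ‖u.comp (e i)‖) ^ q ≤ (ε / (4 * C)) ^ q := by
    refine (hasSum_le hle hs'.hasSum hsum).trans (le_trans ?_ hδ.le)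
    exact sub_le_sub (Real.rpow_le_rpow (norm_nonneg _) h1 hq0.le)
      (Real.rpow_le_rpow (by linarith) h2 hq0.le)
  have key : ‖u - v‖ ≤ ε / 4 * ‖v‖ + 2 * C * (ε / (4 * C)) := by
    refine hZ.norm_le_add hq (by positivity) (by positivity) (by positivity)
      (fun i => sub_nonneg.2 (hmono i)) hs' hB fun i => ?_
    rw [ContinuousLinearMap.sub_comp, hu, hv, hcoord, hcoord]
    exact (hC i).norm_segment_sub_le hC0.le (fun s _ _ => norm_minExt_le_segment _ _ s) hs hst ht
  have h3 : 2 * C * (ε / (4 * C)) = ε / 2 := by field_simp; norm_num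
  rw [h3] at key
  have h4 : ε / 4 * ‖v‖ ≤ ε / 4 * 2 := by gcongr; linarith
  linarith

theorem admits_retraction (hq : 1 ≤ q)
    (h : ∀ ε : ℝ, 0 < ε → ∃ C, 0 < C ∧ ∀ i, ConvexityEstimate (StrongDual 𝕜 (X i)) ε C)
    [∀ i, TopologicalSpace.SeparableSpace (X i)] :
    AdmitsUniformlySimultaneouslyContinuousRetraction 𝕜 Z := by
  choose G h0 hG hfd hd using fun i => exists_exhaustion 𝕜 (X i)
  obtain ⟨r, hr1, hr, hru, hrc⟩ := exists_uniform_retraction (ι := Unit) (X := fun _ => Z)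
    (F := fun _ => sumMinExt e π G)
    (fun _ => hZ.approximationScheme hq (fun i ε hε => (h ε hε).imp fun C hC => ⟨hC.1, hC.2 i⟩)
      h0 hG hfd hd)
    (fun ε hε => by
      obtain ⟨C, hC0, hC⟩ := h (ε / 4) (by positivity)
      obtain ⟨δ, hδ, hE⟩ := hZ.exists_segmentEstimate (G := G) hq hε hC0 hC h0
      exact ⟨δ, hδ, fun _ => hE⟩)
    (fun ε hε => by
      obtain ⟨C, hC0, hC⟩ := h ε hε
      exact ⟨ε + 3 * C, by positivity, fun _ => hZ.continuityEstimate hq hε.le hC0.le hC h0⟩)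
  refine ⟨r (), hr1 (), hr (), ?_, hrc ()⟩
  rw [Metric.uniformContinuous_iff]
  intro ε hε
  obtain ⟨ρ, hρ, H⟩ := hru (ε / 2) (by positivity)
  refine ⟨ρ, hρ, fun f g hfg => ?_⟩
  rw [dist_eq_norm] at hfg ⊢
  linarith [H () f g hfg.le]

end IsDualLpSum

/-! ### Computing the dual norm of a sum -/

section DualNorm

variable {𝕜 : Type*} [RCLike 𝕜]

theorem exists_norm_sub_le_re {X : Type*} [NormedAddCommGroup X] [NormedSpace 𝕜 X]
    (f : StrongDual 𝕜 X) {ε : ℝ} (hε : 0 < ε) :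
    ∃ x : X, ‖x‖ ≤ 1 ∧ ‖f‖ - ε ≤ RCLike.re (f x) := by
  rcases lt_or_ge (‖f‖ - ε) 0 with h | h
  · exact ⟨0, by simp, by simpa using h.le⟩
  obtain ⟨x, hx, hx'⟩ := f.exists_lt_apply_of_lt_opNorm (by linarith : ‖f‖ - ε < ‖f‖)
  obtain ⟨c, hc, hc'⟩ := RCLike.exists_norm_eq_mul_self (f x)
  refine ⟨c • x, by rw [norm_smul, hc, one_mul]; exact hx.le, ?_⟩
  rw [map_smul, smul_eq_mul, ← hc', RCLike.ofReal_re]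
  exact hx'.le

variable {X : ℕ → Type*} [∀ i, NormedAddCommGroup (X i)] [∀ i, NormedSpace 𝕜 (X i)]
  {Z : Type*} [NormedAddCommGroup Z] [NormedSpace 𝕜 Z] {e : ∀ i, X i →L[𝕜] Z}
  {π : ∀ i, Z →L[𝕜] X i} {q : ℝ}

/-- Nearly norming vectors, rotated to make the values of `f` almost real and positive, are scaled
by the weights `c i` and added. -/
theorem sum_mul_norm_comp_le (f : StrongDual 𝕜 Z) (s : Finset ℕ) {c : ℕ → ℝ} (hc : ∀ i, 0 ≤ c i)
    (h : ∀ y : ∀ i, X i, (∀ i, ‖y i‖ ≤ c i) → ‖∑ i ∈ s, e i (y i)‖ ≤ 1) :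
    ∑ i ∈ s, c i * ‖f.comp (e i)‖ ≤ ‖f‖ := by
  refine le_of_forall_pos_le_add fun ε hε => ?_
  have hS : 0 ≤ ∑ i ∈ s, c i := Finset.sum_nonneg fun i _ => hc i
  set η := ε / (∑ i ∈ s, c i + 1) with hη
  have hη0 : 0 < η := by positivity
  choose x hx hx' using fun i => exists_norm_sub_le_re (f.comp (e i)) hη0
  have h1 := h (fun i => ((c i : ℝ) : 𝕜) • x i) fun i => by
    rw [norm_smul, RCLike.norm_ofReal, abs_of_nonneg (hc i)]
    exact mul_le_of_le_one_right (hc i) (hx i)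
  have h2 : ∑ i ∈ s, c i * (‖f.comp (e i)‖ - η) ≤ ‖f‖ := by
    calc ∑ i ∈ s, c i * (‖f.comp (e i)‖ - η)
        ≤ ∑ i ∈ s, c i * RCLike.re (f (e i (x i))) :=
          Finset.sum_le_sum fun i _ => mul_le_mul_of_nonneg_left (hx' i) (hc i)
      _ = RCLike.re (f (∑ i ∈ s, e i (((c i : ℝ) : 𝕜) • x i))) := by
          simp only [map_sum, map_smul, smul_eq_mul, RCLike.re_ofReal_mul]
      _ ≤ ‖f (∑ i ∈ s, e i (((c i : ℝ) : 𝕜) • x i))‖ := RCLike.re_le_norm _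
      _ ≤ ‖f‖ := f.unit_le_opNorm _ h1
  have h3 : η * ∑ i ∈ s, c i ≤ ε := by
    rw [hη, div_mul_eq_mul_div, div_le_iff₀ (by positivity)]
    nlinarith
  simp only [mul_sub, Finset.sum_sub_distrib, ← Finset.sum_mul] at h2
  linarith

theorem hasSum_norm_comp (hq : 0 < q) (f : StrongDual 𝕜 Z)
    (hle : ∀ s : Finset ℕ, ∑ i ∈ s, ‖f.comp (e i)‖ ^ q ≤ ‖f‖ ^ q)
    (hge : ∀ B : ℝ, 0 ≤ B → HasSum (fun i => ‖f.comp (e i)‖ ^ q) (B ^ q) → ‖f‖ ≤ B) :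
    HasSum (fun i => ‖f.comp (e i)‖ ^ q) (‖f‖ ^ q) := by
  have h0 : ∀ i, 0 ≤ ‖f.comp (e i)‖ ^ q := fun i => Real.rpow_nonneg (norm_nonneg _) q
  have hs : Summable fun i => ‖f.comp (e i)‖ ^ q := summable_of_sum_le h0 hle
  have ht := hs.hasSum
  have ht0 : 0 ≤ ∑' i, ‖f.comp (e i)‖ ^ q := tsum_nonneg h0
  rw [← Real.rpow_inv_rpow ht0 hq.ne'] at ht
  have hB := Real.rpow_nonneg ht0 q⁻¹
  have h1 := hge _ hB ht
  have h2 : (∑' i, ‖f.comp (e i)‖ ^ q) ^ q⁻¹ ≤ ‖f‖ := by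
    rw [← Real.rpow_le_rpow_iff hB (norm_nonneg f) hq]
    exact le_of_tendsto' ht hle
  rwa [le_antisymm h2 h1] at ht

end DualNorm

/-! ### The c₀-sum -/

section C0

variable (𝕜 : Type*) [RCLike 𝕜] (X : ℕ → Type*) [∀ i, NormedAddCommGroup (X i)]
  [∀ i, NormedSpace 𝕜 (X i)]

theorem lp_sum_single_apply {p : ℝ≥0∞} (s : Finset ℕ) (y : ∀ i, X i) (j : ℕ) :
    (∑ i ∈ s, lp.single p i (y i)) j = if j ∈ s then y j else 0 := by
  simp only [lp.coeFn_sum, lp.coeFn_single, Finset.sum_apply, Finset.sum_pi_single]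

/-- The embedding of a summand into the `c₀`-sum. -/
noncomputable def c0Single (i : ℕ) : X i →L[𝕜] c0Sum 𝕜 X :=
  (lp.singleContinuousLinearMap 𝕜 X ∞ i).codRestrict (c0Sum 𝕜 X) fun x => by
    refine tendsto_const_nhds.congr' ?_
    filter_upwards [(Set.finite_singleton i).compl_mem_cofinite] with j hj
    rw [lp.singleContinuousLinearMap_apply, lp.single_apply_ne _ _ _ hj, norm_zero]

/-- The projection of the `c₀`-sum to a summand. -/
noncomputable def c0Proj (i : ℕ) : c0Sum 𝕜 X →L[𝕜] X i :=
  (lp.evalCLM 𝕜 X ∞ i).comp (c0Sum 𝕜 X).subtypeL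

theorem coe_sum_c0Single (s : Finset ℕ) (y : ∀ i, X i) :
    ((∑ i ∈ s, c0Single 𝕜 X i (y i) : c0Sum 𝕜 X) : lp X ∞) = ∑ i ∈ s, lp.single ∞ i (y i) := by
  rw [Submodule.coe_sum]
  rfl

theorem hasSum_c0Single (z : c0Sum 𝕜 X) :
    HasSum (fun i => c0Single 𝕜 X i (c0Proj 𝕜 X i z)) z := by
  rw [HasSum, SummationFilter.unconditional_filter, Metric.tendsto_nhds]
  intro ε hε
  have hfin : {i | ¬ ‖(z : lp X ∞) i‖ < ε / 2}.Finite :=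
    (show Tendsto (fun i => ‖(z : lp X ∞) i‖) cofinite (𝓝 0) from z.2).eventually_lt_const
      (half_pos hε)
  filter_upwards [eventually_ge_atTop hfin.toFinset] with s hs
  rw [dist_comm, dist_eq_norm]
  refine lt_of_le_of_lt (?_ : _ ≤ ε / 2) (half_lt_self hε)
  refine lp.norm_le_of_forall_le (half_pos hε).le fun j => ?_
  change ‖(z : lp X ∞) j - ((∑ i ∈ s, c0Single 𝕜 X i (c0Proj 𝕜 X i z) : c0Sum 𝕜 X) : lp X ∞) j‖ ≤ _
  rw [coe_sum_c0Single, lp_sum_single_apply]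
  split_ifs with hj
  · change ‖(z : lp X ∞) j - (z : lp X ∞) j‖ ≤ _
    rw [sub_self, norm_zero]
    exact (half_pos hε).le
  · rw [sub_zero]
    by_contra hcon
    exact hj (hs (hfin.mem_toFinset.2 fun h => hcon h.le))

theorem isDualLpSum_c0 : IsDualLpSum (c0Single 𝕜 X) (c0Proj 𝕜 X) 1 where
  proj_self i x := lp.single_apply_self ∞ i x
  proj_ne i j hij x := lp.single_apply_ne ∞ j x hij
  hasSum := hasSum_c0Single 𝕜 X
  hasSum_norm f := by
    refine hasSum_norm_comp one_pos f (fun s => ?_) fun B hB hs => ?_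
    · have := sum_mul_norm_comp_le (e := c0Single 𝕜 X) f s (c := fun _ => 1)
        (fun _ => zero_le_one) fun y hy => by
          change ‖((∑ i ∈ s, c0Single 𝕜 X i (y i) : c0Sum 𝕜 X) : lp X ∞)‖ ≤ 1
          rw [coe_sum_c0Single]
          refine lp.norm_le_of_forall_le zero_le_one fun j => ?_
          rw [lp_sum_single_apply]
          split_ifs
          · exact hy j
          · rw [norm_zero]; exact zero_le_one
      simpa only [one_mul, Real.rpow_one] using this
    · simp only [Real.rpow_one] at hs
      refine f.opNorm_le_bound hB fun z => ?_
      have h1 := (hasSum_c0Single 𝕜 X z).mapL f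
      rw [← h1.tsum_eq]
      refine tsum_of_norm_bounded (hs.mul_right ‖z‖) fun i => ?_
      exact (f.comp (c0Single 𝕜 X i)).le_opNorm_of_le
        (lp.norm_apply_le_norm ENNReal.top_ne_zero (z : lp X ∞) i)

end C0

/-! ### The ℓ_p-sums with p > 1 -/

section Lp

variable (𝕜 : Type*) [RCLike 𝕜] (X : ℕ → Type*) [∀ i, NormedAddCommGroup (X i)]
  [∀ i, NormedSpace 𝕜 (X i)]

theorem isDualLpSum_lp (p : ℝ≥0∞) [Fact (1 ≤ p)] (hp : p ≠ ∞) {q : ℝ}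
    (hpq : p.toReal.HolderConjugate q) :
    IsDualLpSum (lp.singleContinuousLinearMap 𝕜 X p) (lp.evalCLM 𝕜 X p) q where
  proj_self i x := lp.single_apply_self p i x
  proj_ne i j hij x := lp.single_apply_ne p j x hij
  hasSum z := lp.hasSum_single hp z
  hasSum_norm f := by
    refine hasSum_norm_comp hpq.symm.pos f (fun s => ?_) fun B hB hs => ?_
    -- The weights are the extremizer in Hölder's inequality, a vector of the unit ball of ℓ_p.
    · obtain ⟨⟨g, hg, hg'⟩, -⟩ := NNReal.isGreatest_Lp s
        (fun i => ‖f.comp (lp.singleContinuousLinearMap 𝕜 X p i)‖₊) hpq.symm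
      have h1 := sum_mul_norm_comp_le (e := lp.singleContinuousLinearMap 𝕜 X p) f s
        (c := fun i => g i) (fun i => NNReal.coe_nonneg _) fun y hy => by
          rw [← Real.rpow_le_rpow_iff (norm_nonneg _) zero_le_one hpq.pos, Real.one_rpow]
          refine (lp.norm_sum_single hpq.pos y s).le.trans ?_
          refine (Finset.sum_le_sum fun i _ => Real.rpow_le_rpow (norm_nonneg _) (hy i)
            hpq.pos.le).trans ?_
          exact_mod_cast (hg : ∑ i ∈ s, g i ^ p.toReal ≤ 1)
      have h2 : (∑ i ∈ s, ‖f.comp (lp.singleContinuousLinearMap 𝕜 X p i)‖ ^ q) ^ (1 / q) ≤ ‖f‖ := by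
        refine le_trans (le_of_eq ?_) h1
        have := congrArg NNReal.toReal hg'
        push_cast at this
        rw [← this]
        exact Finset.sum_congr rfl fun i _ => mul_comm _ _
      rw [one_div] at h2
      have h0 : 0 ≤ ∑ i ∈ s, ‖f.comp (lp.singleContinuousLinearMap 𝕜 X p i)‖ ^ q :=
        Finset.sum_nonneg fun i _ => Real.rpow_nonneg (norm_nonneg _) q
      rwa [Real.rpow_inv_le_iff_of_pos h0 (norm_nonneg _) hpq.symm.pos] at h2
    · refine f.opNorm_le_bound hB fun z => ?_
      obtain ⟨D, -, hD, hDs⟩ := Real.inner_le_Lp_mul_Lq_hasSum_of_nonneg hpq.symm hB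
        (norm_nonneg z) (fun i => norm_nonneg _) (fun i => norm_nonneg _) hs
        (lp.hasSum_norm hpq.pos z)
      have h1 := (lp.hasSum_single hp z).mapL f
      refine le_trans ?_ hD
      rw [← h1.tsum_eq]
      exact tsum_of_norm_bounded hDs fun i =>
        (f.comp (lp.singleContinuousLinearMap 𝕜 X p i)).le_opNorm (z i)

end Lp

/-! ### The ℓ_1-sum, coordinate by coordinate -/

section L1

variable {𝕜 : Type*} [RCLike 𝕜] {X : ℕ → Type*} [∀ i, NormedAddCommGroup (X i)]
  [∀ i, NormedSpace 𝕜 (X i)]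

theorem hasSum_norm_l1 (x : lp X 1) : HasSum (fun i => ‖x i‖) ‖x‖ := by
  simpa using lp.hasSum_norm (by simp) x

theorem norm_apply_le_of_norm_le {g : ∀ i, StrongDual 𝕜 (X i)} {K : ℝ} (hg : ∀ i, ‖g i‖ ≤ K)
    (x : lp X 1) (i : ℕ) : ‖g i (x i)‖ ≤ K * ‖x i‖ :=
  (g i).le_of_opNorm_le (hg i) (x i)

theorem summable_apply_l1 {g : ∀ i, StrongDual 𝕜 (X i)} {K : ℝ} (hg : ∀ i, ‖g i‖ ≤ K)
    (x : lp X 1) : Summable fun i => g i (x i) :=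
  ((hasSum_norm_l1 x).summable.mul_left K).of_norm_bounded (norm_apply_le_of_norm_le hg x)

theorem norm_tsum_apply_l1_le {g : ∀ i, StrongDual 𝕜 (X i)} {K : ℝ} (hg : ∀ i, ‖g i‖ ≤ K)
    (x : lp X 1) : ‖∑' i, g i (x i)‖ ≤ K * ‖x‖ :=
  tsum_of_norm_bounded ((hasSum_norm_l1 x).mul_left K) (norm_apply_le_of_norm_le hg x)

/-- The functional on the `ℓ_1`-sum given by a bounded family of functionals. -/
noncomputable def l1Functional (g : ∀ i, StrongDual 𝕜 (X i)) (K : ℝ) (hg : ∀ i, ‖g i‖ ≤ K) :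
    StrongDual 𝕜 (lp X 1) :=
  LinearMap.mkContinuous
    { toFun := fun x => ∑' i, g i (x i)
      map_add' := fun x y => by
        simp only [lp.coeFn_add, Pi.add_apply, map_add]
        exact (summable_apply_l1 hg x).tsum_add (summable_apply_l1 hg y)
      map_smul' := fun c x => by
        simp only [lp.coeFn_smul, Pi.smul_apply, map_smul, smul_eq_mul, RingHom.id_apply]
        exact tsum_mul_left } K (norm_tsum_apply_l1_le hg)

theorem l1Functional_apply (g : ∀ i, StrongDual 𝕜 (X i)) (K : ℝ) (hg : ∀ i, ‖g i‖ ≤ K)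
    (x : lp X 1) : l1Functional g K hg x = ∑' i, g i (x i) := rfl

theorem norm_comp_single_le (f : StrongDual 𝕜 (lp X 1)) (i : ℕ) :
    ‖f.comp (lp.singleContinuousLinearMap 𝕜 X 1 i)‖ ≤ ‖f‖ := by
  refine ContinuousLinearMap.opNorm_le_bound _ (norm_nonneg f) fun x => ?_
  exact (f.le_opNorm _).trans_eq (congrArg _ (lp.norm_single one_pos i x))

theorem admits_retraction_l1
    (h : ∀ ε : ℝ, 0 < ε → ∃ C, 0 < C ∧ ∀ i, ConvexityEstimate (StrongDual 𝕜 (X i)) ε C)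
    [∀ i, TopologicalSpace.SeparableSpace (X i)] :
    AdmitsUniformlySimultaneouslyContinuousRetraction 𝕜 (lp X 1) := by
  choose G h0 hG hfd hd using fun i => exists_exhaustion 𝕜 (X i)
  obtain ⟨r, hr1, hr, hru, hrc⟩ := exists_uniform_retraction
    (F := fun i n => minExt (G i n))
    (fun i => approximationScheme_minExt (fun ε hε => (h ε hε).imp fun C hC => ⟨hC.1, hC.2 i⟩)
      (h0 i) (hG i) (hfd i) (hd i))
    (fun ε hε => by
      obtain ⟨C, hC0, hC⟩ := h (ε / 4) (by positivity)
      exact ⟨min 1 (ε / (8 * C)), by positivity, fun i => segmentEstimate_minExt hC0 hε (hC i) _⟩)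
    (fun ε hε => by
      obtain ⟨C, hC0, hC⟩ := h ε hε
      exact ⟨ε + 3 * C, by positivity, fun i => continuityEstimate_minExt hε.le hC0.le (hC i) _⟩)
  have hb : ∀ f : StrongDual 𝕜 (lp X 1), ∀ i,
      ‖r i (f.comp (lp.singleContinuousLinearMap 𝕜 X 1 i))‖ ≤ 1 := fun f i => hr1 i _
  refine ⟨fun f => l1Functional _ 1 (hb f), fun f => ?_, fun f hf => ?_, ?_, ?_⟩
  · exact LinearMap.mkContinuous_norm_le _ zero_le_one _
  · ext x
    have hi : ∀ i, r i (f.comp (lp.singleContinuousLinearMap 𝕜 X 1 i)) =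
        f.comp (lp.singleContinuousLinearMap 𝕜 X 1 i) := fun i =>
      hr i _ ((norm_comp_single_le f i).trans hf)
    simp only [l1Functional_apply, hi]
    exact ((lp.hasSum_single ENNReal.one_ne_top x).mapL f).tsum_eq
  · rw [Metric.uniformContinuous_iff]
    intro ε hε
    obtain ⟨ρ, hρ, H⟩ := hru (ε / 2) (by positivity)
    refine ⟨ρ, hρ, fun f g hfg => ?_⟩
    rw [dist_eq_norm] at hfg ⊢
    refine lt_of_le_of_lt (?_ : _ ≤ ε / 2) (half_lt_self hε)
    have hi : ∀ i, ‖r i (f.comp (lp.singleContinuousLinearMap 𝕜 X 1 i)) -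
        r i (g.comp (lp.singleContinuousLinearMap 𝕜 X 1 i))‖ ≤ ε / 2 := fun i => by
      refine H i _ _ ?_
      rw [← ContinuousLinearMap.sub_comp]
      exact (norm_comp_single_le (f - g) i).trans hfg.le
    refine ContinuousLinearMap.opNorm_le_bound _ (half_pos hε).le fun x => ?_
    rw [sub_apply, l1Functional_apply, l1Functional_apply,
      ← (summable_apply_l1 (hb f) x).tsum_sub (summable_apply_l1 (hb g) x)]
    exact norm_tsum_apply_l1_le hi x
  · refine WeakDual.continuous_of_continuous_eval fun x => ?_
    -- The terms are dominated by `‖x i‖` independently of the functional, so weak-* continuity in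
    -- each coordinate suffices.
    refine continuous_tsum (fun i => ?_) ((hasSum_norm_l1 x).summable.mul_left 1)
      fun i f => norm_apply_le_of_norm_le (hb (WeakDual.toStrongDual f)) x i
    have h1 : Continuous fun f : WeakDual 𝕜 (lp X 1) => StrongDual.toWeakDual
        ((WeakDual.toStrongDual f).comp (lp.singleContinuousLinearMap 𝕜 X 1 i)) :=
      WeakDual.continuous_of_continuous_eval fun x => WeakDual.eval_continuous _
    exact (WeakDual.eval_continuous (x i)).comp ((hrc i).comp h1)

end L1

/-! ### The main theorem -/

theorem mainTheorem7 {𝕜 : Type*} [RCLike 𝕜] (X : ℕ → Type*)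
    [∀ i, NormedAddCommGroup (X i)] [∀ i, NormedSpace 𝕜 (X i)] [∀ i, CompleteSpace (X i)]
    [∀ i, TopologicalSpace.SeparableSpace (StrongDual 𝕜 (X i))]
    [∀ i, UniformConvexSpace (StrongDual 𝕜 (X i))]
    (hδ : ∀ ε : ℝ, 0 < ε → ε < 1 → 0 < ⨅ i, modulusOfConvexity (StrongDual 𝕜 (X i)) ε) :
    AdmitsUniformlySimultaneouslyContinuousRetraction 𝕜 (c0Sum 𝕜 X) ∧
      ∀ (p : ℝ≥0∞) [Fact (1 ≤ p)], p ≠ ∞ →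
        AdmitsUniformlySimultaneouslyContinuousRetraction 𝕜 (lp X p) := by
  have hsep : ∀ i, TopologicalSpace.SeparableSpace (X i) := fun i => separableSpace_of_dual 𝕜 (X i)
  have h : ∀ ε : ℝ, 0 < ε → ∃ C, 0 < C ∧ ∀ i, ConvexityEstimate (StrongDual 𝕜 (X i)) ε C :=
    fun ε hε => exists_convexityEstimate (fun i => StrongDual 𝕜 (X i)) hδ hε
  refine ⟨(isDualLpSum_c0 𝕜 X).admits_retraction le_rfl h, fun p hp1 hp => ?_⟩
  rcases hp1.out.eq_or_lt with rfl | h1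
  · exact admits_retraction_l1 h
  · have hpq := Real.HolderConjugate.conjExponent
      (show 1 < p.toReal by simpa using (ENNReal.toReal_lt_toReal ENNReal.one_ne_top hp).2 h1)
    exact (isDualLpSum_lp 𝕜 X p hp hpq).admits_retraction hpq.symm.lt.le h
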